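/- Let $n\geqslant 4$, let $\Omega_n=\{1<2<\cdots<n\}$, and let $\mathcal{I}_n$ be the monoid of all partial permutations of $\Omega_n$, maps being written on the right and composed from left to right. Let $\mathcal{ODI}_n$ be the submonoid of $\mathcal{I}_n$ of all order-preserving partial permutations that are restrictions of elements of the dihedral group generated by the permutations $k\mapsto k+1\ (\mathrm{mod}\ n)$ and $k\mapsto n+1-k$ of $\Omega_n$. Put $m=\lfloor\frac{n-1}{2}\rfloor$ and consider the following elements of $\mathcal{ODI}_n$: $x:k\mapsto k+1$ with domain $\{1,\ldots,n-1\}$ and $y=x^{-1}$; for $2\leqslant i\leqslant n-1$, the identity $e_i$ of $\Omega_n\setminus\{i\}$; and, for $1\leqslant i\leqslant m$, the map $x_i$ with domain $\{1,1+i\}$, $1\mapsto 1$, $1+i\mapsto n-i+1$, and $y_i=x_i^{-1}$. These elements are pairwise distinct and form a generating set of $\mathcal{ODI}_n$ of minimum size among its generating sets as a monoid. Let $B=\{x,y,e_2,\ldots,e_{n-1},x_1,\ldots,x_m,y_1,\ldots,y_m\}$ be the corresponding alphabet, and let $V$ be the set of the following relations on $B^*$, where a product $e_a\cdots e_b$ (indices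 increasing by one) is empty if $b<a$, and a chain $u_1=u_2=\cdots=u_k$ stands for the $k-1$ relations $u_j=u_{j+1}$: * $(V_1)$ $e_i^2=e_i$, for $2\leqslant i\leqslant n-1$; * $(V_2)$ $xyx=x$ and $yxy=y$; * $(V_3)$ $yx^2y=xy^2x$; * $(V_4)$ $e_ie_j=e_je_i$, for $2\leqslant i<j\leqslant n-1$; * $(V_5)$ $xye_i=e_ixy$ and $yxe_i=e_iyx$, for $2\leqslant i\leqslant n-1$; * $(V_6)$ $xe_{i+1}=e_ix$, for $2\leqslant i\leqslant n-2$; * $(V_7)$ $x^2y=e_{n-1}x$ and $yx^2=xe_2$; * $(V_8)$ $yxe_2\cdots e_{n-1}xy=xe_2\cdots e_{n-1}xy$; * $(V_9)$ $x_iy_i=e_2\cdots e_ie_{i+2}\cdots e_{n-1}xy$, for $1\leqslant i\leqslant m$; $y_1x_1=e_2\cdots e_{n-1}$; $y_ix_i=e_2\cdots e_{n-i}e_{n-i+2}\cdots e_{n-1}xy$, for $2\leqslant i\leqslant m$; * $(V_{10})$ $x_ie_j=x_i$ and $e_jy_i=y_i$, for $1\leqslant i\leqslant m$, $2\leqslant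 j\leqslant n-1$, $j\neq n-i+1$; * $(V_{11})$ $e_jx_i=x_i$ and $y_ie_j=y_i$, for $1\leqslant i\leqslant m$, $2\leqslant j\leqslant n-1$, $j\neq i+1$; * $(V_{12})$ $x_ixy=xyx_i=x_i$ and $xyy_i=y_ixy=y_i$, for $2\leqslant i\leqslant m$; $xyx_1=x_1$ and $y_1xy=y_1$; * $(V_{13})$ $yxx_1=x_1yx=x^{n-2}e_{n-1}$; $yxx_i=x_iyx=x^{n-2i}e_{n-2i+1}\cdots e_{n-i}e_{n-i+2}\cdots e_{n-1}xy$, for $2\leqslant i\leqslant m$; $yxy_i=y_iyx=y^{n-2i+1}xe_2\cdots e_ie_{i+2}\cdots e_{2i}$, for $1\leqslant i\leqslant m$; * $(V_{14})$ $x_1xy=e_2x_1=y_1e_2=xyy_1=e_2\cdots e_{n-1}xy$; $x_ie_{n-i+1}=e_{i+1}x_i=y_ie_{i+1}=e_{n-i+1}y_i=e_2\cdots e_{n-1}xy$, for $2\leqslant i\leqslant m$. Then $\mathcal{ODI}_n$ is defined by the presentation $\langle B\mid V\rangle$: there is an isomorphism from $B^*/\rho_V$, where $\rho_V$ is the smallest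 congruence on $B^*$ containing $V$, onto $\mathcal{ODI}_n$ that sends the class of each letter to the element denoted by the same symbol. Moreover, $|B|=2n-\frac{3+(-1)^n}{2}$ and $|V|=\frac{1}{2}\left(5n^2-(1+2(-1)^n)n+(-1)^{n+1}-3\right)$. -/

import Mathlib

namespace DihedralInverse

/-- The symmetric inverse monoid on the chain `Ω_n = {1 < 2 < ⋯ < n}`: all partial permutations.
The point `k` of `Ω_n` is the element of `Fin n` with value `k - 1`. -/
abbrev SymInv (n : ℕ) : Type := Fin n ≃. Fin n

/-- Composition is from left to right: `x (α * β) = (x α) β`. -/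
instance instMonoidSymInv (n : ℕ) : Monoid (SymInv n) where
  mul α β := α.trans β
  one := PEquiv.refl (Fin n)
  mul_assoc α β γ := PEquiv.trans_assoc α β γ
  one_mul α := PEquiv.refl_trans α
  mul_one α := PEquiv.trans_refl α

theorem mul_def {n : ℕ} (α β : SymInv n) : α * β = α.trans β := rfl

theorem one_def {n : ℕ} : (1 : SymInv n) = PEquiv.refl (Fin n) := rfl

/-- The dihedral group, generated by the cycle `g = (1 2 ⋯ n)` and the reversal `h`. -/
def dihedral (n : ℕ) : Subgroup (Equiv.Perm (Fin n)) :=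
  Subgroup.closure {finRotate n, Fin.revPerm}

/-- The dihedral inverse monoid `DI_n`: all restrictions of elements of the dihedral group. -/
def DI (n : ℕ) : Submonoid (SymInv n) where
  carrier := {α | ∃ σ ∈ dihedral n, α ≤ σ.toPEquiv}
  one_mem' := ⟨1, one_mem _, le_of_eq Equiv.toPEquiv_refl.symm⟩
  mul_mem' := by
    rintro α β ⟨σ, hσ, hα⟩ ⟨τ, hτ, hβ⟩
    refine ⟨τ * σ, mul_mem hτ hσ, ?_⟩
    intro a c hc
    obtain ⟨b, hb, hc⟩ := (PEquiv.mem_trans α β a c).1 hc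
    have h1 := hα a b hb
    have h2 := hβ b c hc
    simp only [Equiv.toPEquiv_apply, Option.mem_def, Option.some.injEq] at h1 h2 ⊢
    subst h1
    exact h2

/-- The monoid `POI_n` of all order-preserving partial permutations. -/
def POI (n : ℕ) : Submonoid (SymInv n) where
  carrier := {α | ∀ a b a' b' : Fin n, a' ∈ α a → b' ∈ α b → a ≤ b → a' ≤ b'}
  one_mem' := by
    intro a b a' b' ha hb hab
    simp only [one_def, PEquiv.refl_apply, Option.mem_def, Option.some.injEq] at ha hb
    subst ha hb
    exact hab
  mul_mem' := by
    intro α β hα hβ a b a' b' ha hb hab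
    obtain ⟨c, hc, ha⟩ := (PEquiv.mem_trans α β a a').1 ha
    obtain ⟨d, hd, hb⟩ := (PEquiv.mem_trans α β b b').1 hb
    exact hβ c d a' b' ha hb (hα a b c d hc hd hab)

/-- `ODI_n = DI_n ∩ POI_n`. -/
def ODI (n : ℕ) : Submonoid (SymInv n) := DI n ⊓ POI n

/-- The transformation `x : k ↦ k + 1`, for `1 ≤ k ≤ n - 1`. -/
def shift (n : ℕ) : SymInv n where
  toFun a := if h : a.val + 1 < n then some ⟨a.val + 1, h⟩ else none
  invFun b := if 1 ≤ b.val then some ⟨b.val - 1, by omega⟩ else none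
  inv := by
    intro a b
    rcases a with ⟨a, ha⟩
    rcases b with ⟨b, hb⟩
    simp only [Option.ite_none_right_eq_some, Option.dite_none_right_eq_some,
      Option.some.injEq, Fin.mk.injEq]
    constructor
    · rintro ⟨h, rfl⟩
      exact ⟨by omega, by omega⟩
    · rintro ⟨h, h'⟩
      exact ⟨by omega, by omega⟩

/-- The idempotent `e_i`: the identity restricted to `Ω_n ∖ {i}`. -/
def idem (n i : ℕ) : SymInv n := PEquiv.ofSet {a : Fin n | a.val + 1 ≠ i}

/-- The transformation `x_i`: `1 ↦ 1` and `1 + i ↦ n - i + 1`. -/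
def pair (n i : ℕ) (h1 : 1 ≤ i) (hi : i ≤ (n - 1) / 2) : SymInv n where
  toFun a := if a.val = 0 then some ⟨0, by omega⟩
    else if a.val = i then some ⟨n - i, by omega⟩ else none
  invFun b := if b.val = 0 then some ⟨0, by omega⟩
    else if b.val = n - i then some ⟨i, by omega⟩ else none
  inv := by
    intro a b
    rcases a with ⟨a, ha⟩
    rcases b with ⟨b, hb⟩
    have hn : n - i ≠ 0 := by omega
    have hi0 : i ≠ 0 := by omega
    by_cases ha0 : a = 0 <;> by_cases hai : a = i <;> by_cases hb0 : b = 0 <;>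
      by_cases hbi : b = n - i <;> simp [ha0, hai, hb0, hbi, hn, hi0] <;> omega

/-- The alphabet `B`, with the letters `x`, `y`, `e_i` for `2 ≤ i ≤ n - 1`, and
`x_i`, `y_i` for `1 ≤ i ≤ ⌊(n - 1) / 2⌋`. -/
inductive Letter (n : ℕ) : Type
  | x : Letter n
  | y : Letter n
  | e (i : ℕ) (h : 2 ≤ i ∧ i ≤ n - 1) : Letter n
  | xs (i : ℕ) (h : 1 ≤ i ∧ i ≤ (n - 1) / 2) : Letter n
  | ys (i : ℕ) (h : 1 ≤ i ∧ i ≤ (n - 1) / 2) : Letter n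

/-- The transformation of `Ω_n` denoted by the same symbol as a given letter. -/
def gen (n : ℕ) : Letter n → SymInv n
  | .x => shift n
  | .y => (shift n).symm
  | .e i _ => idem n i
  | .xs i h => pair n i h.1 h.2
  | .ys i h => (pair n i h.1 h.2).symm

/-- Words over the alphabet `B`. -/
abbrev Word (n : ℕ) : Type := FreeMonoid (Letter n)

namespace Word

/-- The one-letter word `x`. -/
def x {n : ℕ} : Word n := FreeMonoid.of .x

/-- The one-letter word `y`. -/
def y {n : ℕ} : Word n := FreeMonoid.of .y

/-- The one-letter word `e_i`. It is only used for `2 ≤ i ≤ n - 1`;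
the value for other `i` is immaterial. -/
def e {n : ℕ} (i : ℕ) : Word n :=
  if h : 2 ≤ i ∧ i ≤ n - 1 then FreeMonoid.of (.e i h) else 1

/-- The one-letter word `x_i`. It is only used for `1 ≤ i ≤ ⌊(n - 1) / 2⌋`;
the value for other `i` is immaterial. -/
def xs {n : ℕ} (i : ℕ) : Word n :=
  if h : 1 ≤ i ∧ i ≤ (n - 1) / 2 then FreeMonoid.of (.xs i h) else 1

/-- The one-letter word `y_i`. It is only used for `1 ≤ i ≤ ⌊(n - 1) / 2⌋`;
the value for other `i` is immaterial. -/
def ys {n : ℕ} (i : ℕ) : Word n :=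
  if h : 1 ≤ i ∧ i ≤ (n - 1) / 2 then FreeMonoid.of (.ys i h) else 1

/-- The word `e_a e_{a+1} ⋯ e_b`, which is empty if `b < a`. -/
def es {n : ℕ} (a b : ℕ) : Word n := ((List.range' a (b + 1 - a)).map e).prod

end Word

open Word in
/-- The relations `V_1, …, V_14` over the alphabet `B`: `Rel n u v` says that `u = v` is one of
them. A chain `u_1 = u_2 = ⋯ = u_k` stands for the `k - 1` relations `u_j = u_{j+1}`. -/
inductive Rel (n : ℕ) : Word n → Word n → Prop
  | v1 (i : ℕ) (h : 2 ≤ i ∧ i ≤ n - 1) : Rel n (e i * e i) (e i)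
  | v2_x : Rel n (x * y * x) x
  | v2_y : Rel n (y * x * y) y
  | v3 : Rel n (y * x ^ 2 * y) (x * y ^ 2 * x)
  | v4 (i j : ℕ) (h : 2 ≤ i ∧ i < j ∧ j ≤ n - 1) : Rel n (e i * e j) (e j * e i)
  | v5_xy (i : ℕ) (h : 2 ≤ i ∧ i ≤ n - 1) : Rel n (x * y * e i) (e i * (x * y))
  | v5_yx (i : ℕ) (h : 2 ≤ i ∧ i ≤ n - 1) : Rel n (y * x * e i) (e i * (y * x))
  | v6 (i : ℕ) (h : 2 ≤ i ∧ i ≤ n - 2) : Rel n (x * e (i + 1)) (e i * x)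
  | v7_x : Rel n (x ^ 2 * y) (e (n - 1) * x)
  | v7_y : Rel n (y * x ^ 2) (x * e 2)
  | v8 : Rel n (y * x * es 2 (n - 1) * (x * y)) (x * es 2 (n - 1) * (x * y))
  | v9_xy (i : ℕ) (h : 1 ≤ i ∧ i ≤ (n - 1) / 2) :
      Rel n (xs i * ys i) (es 2 i * es (i + 2) (n - 1) * (x * y))
  | v9_yx_one : Rel n (ys 1 * xs 1) (es 2 (n - 1))
  | v9_yx (i : ℕ) (h : 2 ≤ i ∧ i ≤ (n - 1) / 2) :
      Rel n (ys i * xs i) (es 2 (n - i) * es (n - i + 2) (n - 1) * (x * y))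
  | v10_x (i j : ℕ) (h : 1 ≤ i ∧ i ≤ (n - 1) / 2) (hj : 2 ≤ j ∧ j ≤ n - 1 ∧ j ≠ n - i + 1) :
      Rel n (xs i * e j) (xs i)
  | v10_y (i j : ℕ) (h : 1 ≤ i ∧ i ≤ (n - 1) / 2) (hj : 2 ≤ j ∧ j ≤ n - 1 ∧ j ≠ n - i + 1) :
      Rel n (e j * ys i) (ys i)
  | v11_x (i j : ℕ) (h : 1 ≤ i ∧ i ≤ (n - 1) / 2) (hj : 2 ≤ j ∧ j ≤ n - 1 ∧ j ≠ i + 1) :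
      Rel n (e j * xs i) (xs i)
  | v11_y (i j : ℕ) (h : 1 ≤ i ∧ i ≤ (n - 1) / 2) (hj : 2 ≤ j ∧ j ≤ n - 1 ∧ j ≠ i + 1) :
      Rel n (ys i * e j) (ys i)
  | v12_x (i : ℕ) (h : 2 ≤ i ∧ i ≤ (n - 1) / 2) : Rel n (xs i * (x * y)) (x * y * xs i)
  | v12_x' (i : ℕ) (h : 2 ≤ i ∧ i ≤ (n - 1) / 2) : Rel n (x * y * xs i) (xs i)
  | v12_y (i : ℕ) (h : 2 ≤ i ∧ i ≤ (n - 1) / 2) : Rel n (x * y * ys i) (ys i * (x * y))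
  | v12_y' (i : ℕ) (h : 2 ≤ i ∧ i ≤ (n - 1) / 2) : Rel n (ys i * (x * y)) (ys i)
  | v12_x_one : Rel n (x * y * xs 1) (xs 1)
  | v12_y_one : Rel n (ys 1 * (x * y)) (ys 1)
  | v13_x_one : Rel n (y * x * xs 1) (xs 1 * (y * x))
  | v13_x_one' : Rel n (xs 1 * (y * x)) (x ^ (n - 2) * e (n - 1))
  | v13_x (i : ℕ) (h : 2 ≤ i ∧ i ≤ (n - 1) / 2) : Rel n (y * x * xs i) (xs i * (y * x))
  | v13_x' (i : ℕ) (h : 2 ≤ i ∧ i ≤ (n - 1) / 2) :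
      Rel n (xs i * (y * x))
        (x ^ (n - 2 * i) * es (n - 2 * i + 1) (n - i) * es (n - i + 2) (n - 1) * (x * y))
  | v13_y (i : ℕ) (h : 1 ≤ i ∧ i ≤ (n - 1) / 2) : Rel n (y * x * ys i) (ys i * (y * x))
  | v13_y' (i : ℕ) (h : 1 ≤ i ∧ i ≤ (n - 1) / 2) :
      Rel n (ys i * (y * x)) (y ^ (n - 2 * i + 1) * x * es 2 i * es (i + 2) (2 * i))
  | v14_one : Rel n (xs 1 * (x * y)) (e 2 * xs 1)
  | v14_one' : Rel n (e 2 * xs 1) (ys 1 * e 2)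
  | v14_one'' : Rel n (ys 1 * e 2) (x * y * ys 1)
  | v14_one''' : Rel n (x * y * ys 1) (es 2 (n - 1) * (x * y))
  | v14 (i : ℕ) (h : 2 ≤ i ∧ i ≤ (n - 1) / 2) :
      Rel n (xs i * e (n - i + 1)) (e (i + 1) * xs i)
  | v14' (i : ℕ) (h : 2 ≤ i ∧ i ≤ (n - 1) / 2) : Rel n (e (i + 1) * xs i) (ys i * e (i + 1))
  | v14'' (i : ℕ) (h : 2 ≤ i ∧ i ≤ (n - 1) / 2) :
      Rel n (ys i * e (i + 1)) (e (n - i + 1) * ys i)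
  | v14''' (i : ℕ) (h : 2 ≤ i ∧ i ≤ (n - 1) / 2) :
      Rel n (e (n - i + 1) * ys i) (es 2 (n - 1) * (x * y))

/-- The set `V` of relations, as a set of pairs of words. -/
def V (n : ℕ) : Set (Word n × Word n) := {p | Rel n p.1 p.2}

end DihedralInverse

/-!
An order-preserving restriction of a rotation cannot have points both before and after the place
where the rotation wraps around, so it is a restriction of a translation `a ↦ a + c`. An
order-preserving restriction of a reflection has rank at most two, and in rank two it maps two
points at distance `d` to two points at distance `n - d`. Hence `ODI n` consists of the restrictions
of translations and of the maps `a ↦ c`, `a + d ↦ c + (n - d)` with `2 d ≠ n` (`ODI_cases`).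

*The presentation.* In the presented monoid put `pf 0 = y x`, `pf (n - 1) = x y` and `pf j =
e_{j+1}` for the inner points `j`, numbered from `0`. These are commuting idempotents, each standing
for the removal of one point, and `x`, `y` carry them along (`px_mul_pf_succ`, `py_mul_pf`). So
every product of letters `x`, `y`, `e_i` is equal to a product of some `pf j` followed by a power of
`x` or of `y`. Such an element absorbs `pf j` for each `j` outside its domain (`pf_mul_eq_self`),
and all those with empty domain coincide because of `Rel.v8`; so it is determined by the map it
stands for (`transl_injOn`). Let `pp d` be the letter standing for the map `0 ↦ 0`, `d ↦ n - d`. It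
absorbs all the `pf j`, on either side, except those of the two points of its domain or image, and
with these it becomes a product of letters `x`, `y`, `e_i`; so does `pp d * pp (n - d)`. It follows
that the elements `y ^ a * pp d * x ^ c` with `a + d < n` and `c < d`, together with the products of
letters `x`, `y`, `e_i`, form a set that is closed under right multiplication by letters, hence
make up the whole presented monoid (`isNormal`). The maps that they stand for distinguish them
(`sem_injective`) and exhaust `ODI n` (`exists_sem_eq`).

*Minimality.* The sets `{x}`, `{y}`, `{e_i}`, and, for `d ≠ n / 2`, the set of the maps that send
two points at distance `d` to two points at distance `n - d`, are pairwise disjoint, and each of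
them has a complement in `ODI n` that is closed under products (`primeSet_mul`). Every generating
set therefore meets each of them, and there is one for each letter.

*Counting relations.* A relation in `V` is determined by its left-hand side, and the left-hand sides
are all the words of finitely many shapes (`LhsIdx`), so it suffices to count these.
-/

namespace DihedralInverse

variable {n : ℕ}

/-! ### Partial permutations as relations between integers -/

/-- `Maps α a b` says that the partial permutation `α` sends the point with value `a` to the point
with value `b`. Points are named by integers, so that both a shifted point and the points outside
the chain can be written down; `Maps α a b` forces `0 ≤ a < n` and `0 ≤ b < n`. -/
def Maps (α : SymInv n) (a b : ℤ) : Prop :=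
  ∃ i j : Fin n, ((i : ℕ) : ℤ) = a ∧ ((j : ℕ) : ℤ) = b ∧ j ∈ α i

theorem maps_coe {α : SymInv n} {i j : Fin n} : Maps α (i : ℕ) (j : ℕ) ↔ j ∈ α i := by
  constructor
  · rintro ⟨i', j', hi, hj, h⟩
    obtain rfl : i' = i := by ext; exact_mod_cast hi
    obtain rfl : j' = j := by ext; exact_mod_cast hj
    exact h
  · exact fun h => ⟨i, j, rfl, rfl, h⟩

theorem Maps.bounds {α : SymInv n} {a b : ℤ} (h : Maps α a b) :
    0 ≤ a ∧ a < n ∧ 0 ≤ b ∧ b < n := by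
  obtain ⟨i, j, rfl, rfl, -⟩ := h
  have := i.2
  have := j.2
  omega

theorem maps_mk {α : SymInv n} {a b : ℕ} (ha : a < n) (hb : b < n) :
    Maps α a b ↔ (⟨b, hb⟩ : Fin n) ∈ α ⟨a, ha⟩ :=
  maps_coe (i := ⟨a, ha⟩) (j := ⟨b, hb⟩)

theorem Maps.right_unique {α : SymInv n} {a b b' : ℤ} (h : Maps α a b) (h' : Maps α a b') :
    b = b' := by
  obtain ⟨i, j, rfl, rfl, h⟩ := h
  obtain ⟨i', j', hi, rfl, h'⟩ := h'
  obtain rfl : i' = i := by ext; exact_mod_cast hi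
  rw [Option.mem_unique h h']

theorem Maps.left_unique {α : SymInv n} {a a' b : ℤ} (h : Maps α a b) (h' : Maps α a' b) :
    a = a' := by
  obtain ⟨i, j, rfl, rfl, h⟩ := h
  obtain ⟨i', j', rfl, hj, h'⟩ := h'
  obtain rfl : j' = j := by ext; exact_mod_cast hj
  rw [α.inj h h']

theorem ext_maps {α β : SymInv n} (h : ∀ a b, Maps α a b ↔ Maps β a b) : α = β := by
  refine PEquiv.ext fun i => Option.ext fun j => ?_
  have := h (i : ℕ) (j : ℕ)
  rwa [maps_coe, maps_coe] at this

theorem maps_mul {α β : SymInv n} {a c : ℤ} :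
    Maps (α * β) a c ↔ ∃ b, Maps α a b ∧ Maps β b c := by
  constructor
  · rintro ⟨i, k, rfl, rfl, h⟩
    obtain ⟨j, hj, hk⟩ := (PEquiv.mem_trans α β i k).1 h
    exact ⟨(j : ℕ), maps_coe.2 hj, maps_coe.2 hk⟩
  · rintro ⟨b, ⟨i, j, rfl, rfl, h⟩, h'⟩
    obtain ⟨j', k, hj, rfl, h'⟩ := h'
    obtain rfl : j' = j := by ext; exact_mod_cast hj
    exact ⟨i, k, rfl, rfl, (PEquiv.mem_trans α β i k).2 ⟨_, h, h'⟩⟩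

theorem maps_symm {α : SymInv n} {a b : ℤ} : Maps α.symm a b ↔ Maps α b a := by
  constructor
  · rintro ⟨i, j, hi, hj, h⟩
    exact ⟨j, i, hj, hi, (PEquiv.mem_iff_mem α).1 h⟩
  · rintro ⟨i, j, hi, hj, h⟩
    exact ⟨j, i, hj, hi, (PEquiv.mem_iff_mem α).2 h⟩

@[simp]
theorem maps_one {a b : ℤ} : Maps (1 : SymInv n) a b ↔ a = b ∧ 0 ≤ a ∧ a < n := by
  constructor
  · intro h
    have hb := h.bounds
    obtain ⟨i, j, rfl, rfl, h⟩ := h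
    simp only [one_def, PEquiv.refl_apply, Option.mem_def, Option.some.injEq] at h
    subst h
    exact ⟨rfl, hb.1, hb.2.1⟩
  · rintro ⟨rfl, h0, h1⟩
    lift a to ℕ using h0
    have h1 : a < n := by omega
    simp [maps_mk h1 h1, one_def]

theorem maps_shift {a b : ℤ} : Maps (shift n) a b ↔ b = a + 1 ∧ 0 ≤ a ∧ b < n := by
  constructor
  · intro h
    have hb := h.bounds
    obtain ⟨i, j, rfl, rfl, h⟩ := h
    simp only [shift, PEquiv.coe_mk, Option.mem_def, Option.dite_none_right_eq_some,
      Option.some.injEq, Fin.ext_iff] at h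
    omega
  · rintro ⟨rfl, h0, h1⟩
    lift a to ℕ using h0
    have h1 : a + 1 < n := by omega
    have := maps_mk (α := shift n) (a := a) (b := a + 1) (by omega) h1
    push_cast at this
    rw [this]
    simp [shift, h1]

theorem maps_idem {i : ℕ} {a b : ℤ} :
    Maps (idem n i) a b ↔ a = b ∧ 0 ≤ a ∧ a < n ∧ a + 1 ≠ i := by
  constructor
  · intro h
    have hb := h.bounds
    obtain ⟨k, j, rfl, rfl, h⟩ := h
    simp only [idem, PEquiv.mem_ofSet_iff, Set.mem_ofPred_eq] at h
    obtain ⟨rfl, h⟩ := h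
    omega
  · rintro ⟨rfl, h0, h1, h2⟩
    lift a to ℕ using h0
    have h1 : a < n := by omega
    rw [maps_mk h1 h1, idem, PEquiv.mem_ofSet_iff]
    simp only [Set.mem_ofPred_eq, true_and]
    omega

theorem maps_pair {i : ℕ} {h1 : 1 ≤ i} {hi : i ≤ (n - 1) / 2} {a b : ℤ} :
    Maps (pair n i h1 hi) a b ↔ a = 0 ∧ b = 0 ∨ a = i ∧ b = n - i := by
  constructor
  · intro h
    have hb := h.bounds
    obtain ⟨k, j, rfl, rfl, h⟩ := h
    simp only [pair, PEquiv.coe_mk, Option.mem_def] at h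
    split_ifs at h <;> simp only [Option.some.injEq, Fin.ext_iff] at h <;> omega
  · have e : ((n - i : ℕ) : ℤ) = n - i := by omega
    rintro (⟨rfl, rfl⟩ | ⟨rfl, rfl⟩)
    · have := maps_mk (α := pair n i h1 hi) (a := 0) (b := 0) (by omega) (by omega)
      push_cast at this
      rw [this]
      simp [pair]
    · have := maps_mk (α := pair n i h1 hi) (a := i) (b := n - i) (by omega) (by omega)
      rw [e] at this
      rw [this]
      have h0 : i ≠ 0 := by omega
      simp [pair, h0]

/-! ### Multiplication on the right by generators -/

theorem maps_mul_shift {α : SymInv n} {a b : ℤ} :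
    Maps (α * shift n) a b ↔ Maps α a (b - 1) ∧ b < n := by
  rw [maps_mul]
  constructor
  · rintro ⟨c, h, h'⟩
    obtain ⟨rfl, h1, h2⟩ := maps_shift.1 h'
    exact ⟨by simpa using h, h2⟩
  · rintro ⟨h, hb⟩
    exact ⟨_, h, maps_shift.2 ⟨by ring, h.bounds.2.2.1, hb⟩⟩

theorem maps_mul_shift_symm {α : SymInv n} {a b : ℤ} :
    Maps (α * (shift n).symm) a b ↔ Maps α a (b + 1) ∧ 0 ≤ b := by
  rw [maps_mul]
  constructor
  · rintro ⟨c, h, h'⟩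
    obtain ⟨rfl, h1, h2⟩ := maps_shift.1 (maps_symm.1 h')
    exact ⟨h, h1⟩
  · rintro ⟨h, hb⟩
    exact ⟨_, h, maps_symm.2 (maps_shift.2 ⟨rfl, hb, h.bounds.2.2.2⟩)⟩

theorem maps_mul_idem {α : SymInv n} {i : ℕ} {a b : ℤ} :
    Maps (α * idem n i) a b ↔ Maps α a b ∧ b + 1 ≠ i := by
  rw [maps_mul]
  constructor
  · rintro ⟨c, h, h'⟩
    obtain ⟨rfl, -, -, h2⟩ := maps_idem.1 h'
    exact ⟨h, h2⟩
  · rintro ⟨h, hb⟩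
    exact ⟨_, h, maps_idem.2 ⟨rfl, h.bounds.2.2.1, h.bounds.2.2.2, hb⟩⟩

theorem maps_mul_pair {α : SymInv n} {i : ℕ} {h1 : 1 ≤ i} {hi : i ≤ (n - 1) / 2} {a b : ℤ} :
    Maps (α * pair n i h1 hi) a b ↔ b = 0 ∧ Maps α a 0 ∨ b = n - i ∧ Maps α a i := by
  simp only [maps_mul, maps_pair]
  constructor
  · rintro ⟨c, h, ⟨rfl, rfl⟩ | ⟨rfl, rfl⟩⟩ <;> simp [h]
  · rintro (⟨rfl, h⟩ | ⟨rfl, h⟩)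
    · exact ⟨_, h, by simp⟩
    · exact ⟨_, h, by simp⟩

theorem maps_mul_pair_symm {α : SymInv n} {i : ℕ} {h1 : 1 ≤ i} {hi : i ≤ (n - 1) / 2} {a b : ℤ} :
    Maps (α * (pair n i h1 hi).symm) a b ↔ b = 0 ∧ Maps α a 0 ∨ b = i ∧ Maps α a (n - i) := by
  simp only [maps_mul, maps_symm, maps_pair]
  constructor
  · rintro ⟨c, h, ⟨rfl, rfl⟩ | ⟨rfl, rfl⟩⟩ <;> simp [h]
  · rintro (⟨rfl, h⟩ | ⟨rfl, h⟩)
    · exact ⟨_, h, by simp⟩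
    · exact ⟨_, h, by simp⟩

theorem maps_mul_shift_pow {α : SymInv n} {k : ℕ} {a b : ℤ} :
    Maps (α * shift n ^ k) a b ↔ Maps α a (b - k) ∧ b < n := by
  induction k generalizing b with
  | zero => simpa using fun h : Maps α a b => h.bounds.2.2.2
  | succ k ih =>
    rw [pow_succ, ← mul_assoc, maps_mul_shift, ih]
    push_cast
    rw [show b - 1 - (k : ℤ) = b - (k + 1) by ring]
    exact ⟨fun h => ⟨h.1.1, h.2⟩, fun h => ⟨⟨h.1, by omega⟩, h.2⟩⟩

theorem maps_mul_shift_symm_pow {α : SymInv n} {k : ℕ} {a b : ℤ} :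
    Maps (α * (shift n).symm ^ k) a b ↔ Maps α a (b + k) ∧ 0 ≤ b := by
  induction k generalizing b with
  | zero => simpa using fun h : Maps α a b => h.bounds.2.2.1
  | succ k ih =>
    rw [pow_succ, ← mul_assoc, maps_mul_shift_symm, ih]
    push_cast
    rw [show b + 1 + (k : ℤ) = b + (k + 1) by ring]
    exact ⟨fun h => ⟨h.1.1, h.2⟩, fun h => ⟨⟨h.1, by omega⟩, h.2⟩⟩

/-- The partial permutation denoted by a word. -/
def eval (n : ℕ) : Word n →* SymInv n := FreeMonoid.lift (gen n)

theorem eval_of (b : Letter n) : eval n (FreeMonoid.of b) = gen n b := FreeMonoid.lift_eval_of _ _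

@[simp] theorem eval_x : eval n Word.x = shift n := eval_of _

@[simp] theorem eval_y : eval n Word.y = (shift n).symm := eval_of _

theorem eval_e {i : ℕ} (h : 2 ≤ i ∧ i ≤ n - 1) : eval n (Word.e i) = idem n i := by
  rw [Word.e, dif_pos h, eval_of, gen]

theorem eval_xs {i : ℕ} (h : 1 ≤ i ∧ i ≤ (n - 1) / 2) :
    eval n (Word.xs i) = pair n i h.1 h.2 := by
  rw [Word.xs, dif_pos h, eval_of, gen]

theorem eval_ys {i : ℕ} (h : 1 ≤ i ∧ i ≤ (n - 1) / 2) :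
    eval n (Word.ys i) = (pair n i h.1 h.2).symm := by
  rw [Word.ys, dif_pos h, eval_of, gen]

theorem maps_mul_eval_es {α : SymInv n} {lo hi : ℕ} (h : 2 ≤ lo) (h' : hi ≤ n - 1) {a b : ℤ} :
    Maps (α * eval n (Word.es lo hi)) a b ↔ Maps α a b ∧ (b + 1 < lo ∨ (hi : ℤ) < b + 1) := by
  obtain ⟨k, hk⟩ : ∃ k, k = hi + 1 - lo := ⟨_, rfl⟩
  unfold Word.es
  rw [← hk]
  induction k generalizing lo α with
  | zero => simp; omega
  | succ k ih =>
    rw [List.range'_succ, List.map_cons, List.prod_cons, map_mul, ← mul_assoc,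
      ih (by omega) (by omega), eval_e (by omega), maps_mul_idem]
    push_cast
    constructor
    · rintro ⟨⟨h1, h2⟩, h3⟩
      exact ⟨h1, by omega⟩
    · rintro ⟨h1, h2⟩
      exact ⟨⟨h1, by omega⟩, by omega⟩

/-! ### The relations hold -/

theorem eval_eq_of_maps {u v : Word n}
    (h : ∀ a b, Maps (1 * eval n u) a b ↔ Maps (1 * eval n v) a b) : eval n u = eval n v := by
  rw [← one_mul (eval n u), ← one_mul (eval n v)]
  exact ext_maps h

/-- Each relation in `V` holds in the symmetric inverse monoid. -/
theorem Rel.eval_eq (hn : 4 ≤ n) {u v : Word n} (h : Rel n u v) : eval n u = eval n v := by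
  refine eval_eq_of_maps fun a b => ?_
  cases h <;>
  · simp (disch := omega) only [map_mul, map_pow, eval_x, eval_y, eval_e, eval_xs, eval_ys,
      ← mul_assoc, maps_mul_shift, maps_mul_shift_symm, maps_mul_idem, maps_mul_pair,
      maps_mul_pair_symm, maps_mul_shift_pow, maps_mul_shift_symm_pow, maps_mul_eval_es, maps_one,
      true_and]
    omega

/-! ### The elements of `ODI n` -/

theorem POI_iff {α : SymInv n} :
    α ∈ POI n ↔ ∀ a b a' b', Maps α a a' → Maps α b b' → a ≤ b → a' ≤ b' := by
  constructor
  · rintro h a b a' b' ⟨i, i', rfl, rfl, hi⟩ ⟨j, j', rfl, rfl, hj⟩ hab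
    exact_mod_cast h i j i' j' hi hj (by exact_mod_cast hab)
  · intro h i j i' j' hi hj hij
    exact_mod_cast h _ _ _ _ (maps_coe.2 hi) (maps_coe.2 hj) (by exact_mod_cast hij)

theorem lt_of_mem_POI {α : SymInv n} (h : α ∈ POI n) {a b a' b' : ℤ} (ha : Maps α a a')
    (hb : Maps α b b') (hab : a < b) : a' < b' := by
  refine lt_of_le_of_ne (POI_iff.1 h _ _ _ _ ha hb hab.le) ?_
  rintro rfl
  exact hab.ne (ha.left_unique hb)

theorem symm_mem_POI {α : SymInv n} (h : α ∈ POI n) : α.symm ∈ POI n := by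
  rw [POI_iff]
  intro a b a' b' ha hb hab
  rw [maps_symm] at ha hb
  by_contra hlt
  have := lt_of_mem_POI h hb ha (by omega)
  omega

theorem symm_mem_DI {α : SymInv n} (h : α ∈ DI n) : α.symm ∈ DI n := by
  obtain ⟨σ, hσ, hα⟩ := h
  refine ⟨σ⁻¹, inv_mem hσ, ?_⟩
  intro i j hj
  rw [PEquiv.mem_iff_mem] at hj
  have := hα j i hj
  simp only [Equiv.toPEquiv_apply, Option.mem_def, Option.some.injEq] at this ⊢
  rw [← this]
  simp

theorem symm_mem_ODI {α : SymInv n} (h : α ∈ ODI n) : α.symm ∈ ODI n :=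
  ⟨symm_mem_DI h.1, symm_mem_POI h.2⟩

theorem mem_DI_of_maps {α : SymInv n} {σ : Equiv.Perm (Fin n)} (hσ : σ ∈ dihedral n)
    (h : ∀ i j : Fin n, Maps α (i : ℕ) (j : ℕ) → (σ i : ℕ) = (j : ℕ)) : α ∈ DI n := by
  refine ⟨σ, hσ, fun i j hj => ?_⟩
  simp only [Equiv.toPEquiv_apply, Option.mem_def, Option.some.injEq]
  exact Fin.ext (h i j (maps_coe.2 hj))

theorem finRotate_val (i : Fin n) : (finRotate n i : ℕ) = (i + 1) % n := by
  cases n with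
  | zero => exact i.elim0
  | succ n => simp [Fin.val_add]

theorem gen_mem_ODI (b : Letter n) : gen n b ∈ ODI n := by
  have hg : finRotate n ∈ dihedral n := Subgroup.subset_closure (by simp)
  have hh : Fin.revPerm ∈ dihedral n := Subgroup.subset_closure (by simp)
  have hshift : shift n ∈ ODI n := by
    refine ⟨mem_DI_of_maps hg fun i j h => ?_, ?_⟩
    · rw [maps_shift] at h
      rw [finRotate_val, Nat.mod_eq_of_lt (by omega)]
      omega
    · simp only [SetLike.mem_coe, POI_iff, maps_shift]
      omega
  have hpair (i : ℕ) (h : 1 ≤ i ∧ i ≤ (n - 1) / 2) : pair n i h.1 h.2 ∈ ODI n := by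
    refine ⟨mem_DI_of_maps (mul_mem hg hh) fun k j hj => ?_, ?_⟩
    · rw [maps_pair] at hj
      rw [Equiv.Perm.mul_apply, finRotate_val, Fin.revPerm_apply, Fin.val_rev]
      rcases hj with hj | hj
      · rw [show n - (k + 1) + 1 = n by omega, Nat.mod_self]
        omega
      · rw [Nat.mod_eq_of_lt (by omega)]
        omega
    · simp only [SetLike.mem_coe, POI_iff, maps_pair]
      omega
  cases b with
  | x => exact hshift
  | y => exact symm_mem_ODI hshift
  | e i h =>
    refine ⟨mem_DI_of_maps (one_mem _) fun i j h => ?_, ?_⟩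
    · rw [gen, maps_idem] at h
      simpa using h.1
    · simp only [SetLike.mem_coe, POI_iff, gen, maps_idem]
      omega
  | xs i h => exact hpair i h
  | ys i h => exact symm_mem_ODI (hpair i h)

/-- An element of the dihedral group acts modulo `n` as `a ↦ a + c` or as `a ↦ c - a`. -/
theorem dihedral_modEq {σ : Equiv.Perm (Fin n)} (h : σ ∈ dihedral n) :
    (∃ c : ℤ, ∀ i, ((σ i : ℕ) : ℤ) ≡ (i : ℕ) + c [ZMOD n]) ∨
      ∃ c : ℤ, ∀ i, ((σ i : ℕ) : ℤ) ≡ c - (i : ℕ) [ZMOD n] := by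
  induction h using Subgroup.closure_induction with
  | mem σ hσ =>
    rcases hσ with rfl | rfl
    · refine .inl ⟨1, fun i => ?_⟩
      rw [finRotate_val]
      push_cast
      exact Int.mod_modEq _ _
    · refine .inr ⟨n - 1, fun i => ?_⟩
      rw [Fin.revPerm_apply, Fin.val_rev]
      have := i.2
      rw [show ((n - (i + 1) : ℕ) : ℤ) = n - 1 - (i : ℕ) by omega]
  | one => exact .inl ⟨0, fun i => by simp⟩
  | mul σ τ _ _ hσ hτ =>
    rcases hσ with ⟨c, hc⟩ | ⟨c, hc⟩ <;> rcases hτ with ⟨d, hd⟩ | ⟨d, hd⟩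
    · refine .inl ⟨d + c, fun i => (hc _).trans ?_⟩
      rw [← add_assoc]
      exact (hd i).add_right c
    · refine .inr ⟨d + c, fun i => (hc _).trans ?_⟩
      rw [show d + c - (i : ℕ) = d - (i : ℕ) + c by ring]
      exact (hd i).add_right c
    · refine .inr ⟨c - d, fun i => (hc _).trans ?_⟩
      rw [show c - d - (i : ℕ) = c - ((i : ℕ) + d) by ring]
      exact (hd i).sub_left c
    · refine .inl ⟨c - d, fun i => (hc _).trans ?_⟩
      rw [show (i : ℕ) + (c - d) = c - (d - (i : ℕ)) by ring]
      exact (hd i).sub_left c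
  | inv σ _ hσ =>
    rcases hσ with ⟨c, hc⟩ | ⟨c, hc⟩
    · refine .inl ⟨-c, fun i => ?_⟩
      have := (hc (σ⁻¹ i)).symm.sub_right c
      simpa [← sub_eq_add_neg] using this
    · refine .inr ⟨c, fun i => ?_⟩
      have := (hc (σ⁻¹ i)).symm.sub_left c
      simpa using this

/-- A number congruent to `0` modulo `n` and strictly between `0` and `2 n` is `n`. -/
theorem eq_of_modEq_zero {t : ℤ} (h : t ≡ 0 [ZMOD n]) (h0 : 0 < t) (h1 : t < 2 * n) : t = n := by
  obtain ⟨k, rfl⟩ := Int.modEq_zero_iff_dvd.1 h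
  have hn : (0 : ℤ) < n := by omega
  have : 0 < k := pos_of_mul_pos_right h0 hn.le
  have : k < 2 := lt_of_mul_lt_mul_left (by linarith) hn.le
  obtain rfl : k = 1 := by omega
  ring

/-- An element of `ODI n` is either a restriction of a translation, or a map between two-element
sets whose distances add up to `n`. -/
theorem ODI_cases {α : SymInv n} (h : α ∈ ODI n) :
    (∃ c : ℤ, ∀ a b, Maps α a b → b = a + c) ∨
      ∃ a b a' b' : ℤ, a < b ∧ a' < b' ∧ (b - a) + (b' - a') = n ∧ Maps α a a' ∧ Maps α b b' ∧
        ∀ c c', Maps α c c' → c = a ∨ c = b := by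
  obtain ⟨⟨σ, hσ, hα⟩, hp⟩ := h
  have hval (i j : Fin n) (hj : j ∈ α i) : σ i = j := by
    simpa using hα i j hj
  by_cases hne : ∃ a a', Maps α a a'
  swap
  · exact .inl ⟨0, fun a b h => (hne ⟨a, b, h⟩).elim⟩
  rcases dihedral_modEq hσ with ⟨c, hc⟩ | ⟨c, hc⟩
  · left
    have hM (a a' : ℤ) (h : Maps α a a') : a' ≡ a + c [ZMOD n] := by
      obtain ⟨i, j, rfl, rfl, hij⟩ := h
      rw [← hval i j hij]
      exact hc i
    have hlt (a a' b b' : ℤ) (ha : Maps α a a') (hb : Maps α b b') (hab : a < b) :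
        b' - b = a' - a := by
      have h1 := lt_of_mem_POI hp ha hb hab
      have h2 := ((hM b b' hb).sub (hM a a' ha)).sub_right (b - a)
      have := ha.bounds
      have := hb.bounds
      have h3 : (n : ℤ) + ((b' - a') - (b - a)) ≡ 0 [ZMOD n] := by
        rw [Int.modEq_zero_iff_dvd]
        refine dvd_add dvd_rfl ?_
        rw [← Int.modEq_zero_iff_dvd]
        refine h2.trans ?_
        rw [show b + c - (a + c) - (b - a) = 0 by ring]
      have := eq_of_modEq_zero h3 (by omega) (by omega)
      omega
    obtain ⟨a, a', ha⟩ := hne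
    refine ⟨a' - a, fun b b' hb => ?_⟩
    rcases lt_trichotomy a b with hab | rfl | hab
    · have := hlt _ _ _ _ ha hb hab
      omega
    · have := ha.right_unique hb
      omega
    · have := hlt _ _ _ _ hb ha hab
      omega
  · have hM (a a' : ℤ) (h : Maps α a a') : a' ≡ c - a [ZMOD n] := by
      obtain ⟨i, j, rfl, rfl, hij⟩ := h
      rw [← hval i j hij]
      exact hc i
    have hlt (a a' b b' : ℤ) (ha : Maps α a a') (hb : Maps α b b') (hab : a < b) :
        (b - a) + (b' - a') = n := by
      have h1 := lt_of_mem_POI hp ha hb hab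
      have h2 := ((hM b b' hb).sub (hM a a' ha)).add_left (b - a)
      have := ha.bounds
      have := hb.bounds
      refine eq_of_modEq_zero (h2.trans ?_) (by omega) (by omega)
      rw [show b - a + (c - b - (c - a)) = 0 by ring]
    obtain ⟨a₀, a₀', ha₀⟩ := hne
    by_cases h2 : ∃ b b', Maps α b b' ∧ b ≠ a₀
    swap
    · left
      refine ⟨a₀' - a₀, fun b b' hb => ?_⟩
      obtain rfl : b = a₀ := by
        by_contra hb'
        exact h2 ⟨b, b', hb, hb'⟩
      have := ha₀.right_unique hb
      omega
    · right
      have key (a a' b b' : ℤ) (ha : Maps α a a') (hb : Maps α b b') (hab : a < b) :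
          ∃ a b a' b' : ℤ, a < b ∧ a' < b' ∧ (b - a) + (b' - a') = n ∧ Maps α a a' ∧
            Maps α b b' ∧ ∀ c c', Maps α c c' → c = a ∨ c = b := by
        refine ⟨a, b, a', b', hab, lt_of_mem_POI hp ha hb hab, hlt _ _ _ _ ha hb hab, ha, hb,
          fun d d' hd => ?_⟩
        -- three points of the domain would give three distances, one the sum of the other two
        have h1 := hlt _ _ _ _ ha hb hab
        have := hd.bounds
        by_contra hne
        push Not at hne
        rcases lt_or_gt_of_ne hne.1 with h2 | h2 <;> rcases lt_or_gt_of_ne hne.2 with h3 | h3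
        · have := hlt _ _ _ _ hd ha h2
          have := hlt _ _ _ _ hd hb h3
          omega
        · omega
        · have := hlt _ _ _ _ ha hd h2
          have := hlt _ _ _ _ hd hb h3
          omega
        · have := hlt _ _ _ _ ha hd h2
          have := hlt _ _ _ _ hb hd h3
          omega
      obtain ⟨b, b', hb, hba⟩ := h2
      rcases lt_or_gt_of_ne hba with h | h
      · exact key _ _ _ _ hb ha₀ h
      · exact key _ _ _ _ ha₀ hb h

/-! ### Minimality of the generating set -/

/-- The partial permutations that send some two points at distance `d` to two points at distance
`n - d`. -/
def Flips (n : ℕ) (d : ℤ) : Set (SymInv n) :=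
  {α | ∃ a a' b b', Maps α a a' ∧ Maps α b b' ∧ b - a = d ∧ b' - a' = n - d}

/-- A set of elements of `ODI n` attached to each letter, which contains the generator denoted by
that letter and cannot be reached by multiplying elements of `ODI n` outside it. -/
def primeSet (n : ℕ) : Letter n → Set (SymInv n)
  | .x => {shift n}
  | .y => {(shift n).symm}
  | .e i _ => {idem n i}
  | .xs i _ => Flips n i
  | .ys i _ => Flips n (n - i)

theorem gen_mem_primeSet (b : Letter n) : gen n b ∈ primeSet n b := by
  cases b with
  | x => rfl
  | y => rfl
  | e i h => rfl
  | xs i h =>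
    exact ⟨0, 0, i, n - i, (maps_pair (h1 := h.1) (hi := h.2)).2 (by simp),
      (maps_pair (h1 := h.1) (hi := h.2)).2 (by simp), by simp, by simp⟩
  | ys i h =>
    exact ⟨0, 0, n - i, i, maps_symm.2 (maps_pair.2 (by simp)), maps_symm.2 (maps_pair.2 (by simp)),
      by simp, by simp⟩

theorem eq_of_mem_Flips {α : SymInv n} (h : α ∈ ODI n) {d d' : ℤ} (hd : 0 < d) (hd' : 0 < d')
    (h2 : 2 * d ≠ n) (hα : α ∈ Flips n d) (hα' : α ∈ Flips n d') : d = d' := by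
  obtain ⟨a, a', b, b', ha, hb, h3, h4⟩ := hα
  obtain ⟨e, e', f, f', he, hf, h5, h6⟩ := hα'
  rcases ODI_cases h with ⟨c, hc⟩ | ⟨p, q, p', q', -, -, -, -, -, hall⟩
  · have := hc _ _ ha
    have := hc _ _ hb
    omega
  · have := hall _ _ ha
    have := hall _ _ hb
    have := hall _ _ he
    have := hall _ _ hf
    omega

theorem shift_notMem_Flips {d : ℤ} (h2 : 2 * d ≠ n) : shift n ∉ Flips n d := by
  rintro ⟨a, a', b, b', ha, hb, h3, h4⟩
  rw [maps_shift] at ha hb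
  omega

theorem shift_symm_notMem_Flips {d : ℤ} (h2 : 2 * d ≠ n) : (shift n).symm ∉ Flips n d := by
  rintro ⟨a, a', b, b', ha, hb, h3, h4⟩
  rw [maps_symm, maps_shift] at ha hb
  omega

theorem idem_notMem_Flips {i : ℕ} {d : ℤ} (h2 : 2 * d ≠ n) : idem n i ∉ Flips n d := by
  rintro ⟨a, a', b, b', ha, hb, h3, h4⟩
  rw [maps_idem] at ha hb
  omega

theorem shift_ne_shift_symm (hn : 4 ≤ n) : shift n ≠ (shift n).symm := by
  intro h
  have h1 : Maps (shift n) 0 1 := maps_shift.2 (by omega)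
  rw [h, maps_symm, maps_shift] at h1
  omega

theorem shift_ne_idem (hn : 4 ≤ n) (i : ℕ) : shift n ≠ idem n i := by
  intro h
  have h1 : Maps (shift n) 0 1 := maps_shift.2 (by omega)
  rw [h, maps_idem] at h1
  omega

theorem shift_symm_ne_idem (hn : 4 ≤ n) (i : ℕ) : (shift n).symm ≠ idem n i := by
  intro h
  have h1 : Maps (shift n).symm 1 0 := maps_symm.2 (maps_shift.2 (by omega))
  rw [h, maps_idem] at h1
  omega

theorem eq_of_idem_eq {i j : ℕ} (hj : 2 ≤ j ∧ j ≤ n - 1)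
    (h : idem n i = idem n j) : i = j := by
  by_contra hij
  have h1 : Maps (idem n i) (j - 1) (j - 1) := maps_idem.2 (by omega)
  rw [h, maps_idem] at h1
  omega

theorem primeSet_disjoint (hn : 4 ≤ n) {α : SymInv n} (h : α ∈ ODI n) {b c : Letter n}
    (hb : α ∈ primeSet n b) (hc : α ∈ primeSet n c) : b = c := by
  cases b <;> cases c <;> simp only [primeSet, Set.mem_singleton_iff] at hb hc
  case x.x => rfl
  case x.y => exact (shift_ne_shift_symm hn (hb.symm.trans hc)).elim
  case x.e => exact (shift_ne_idem hn _ (hb.symm.trans hc)).elim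
  case x.xs i hi => exact (shift_notMem_Flips (by omega) (hb ▸ hc)).elim
  case x.ys i hi => exact (shift_notMem_Flips (by omega) (hb ▸ hc)).elim
  case y.x => exact (shift_ne_shift_symm hn (hc.symm.trans hb)).elim
  case y.y => rfl
  case y.e => exact (shift_symm_ne_idem hn _ (hb.symm.trans hc)).elim
  case y.xs i hi => exact (shift_symm_notMem_Flips (by omega) (hb ▸ hc)).elim
  case y.ys i hi => exact (shift_symm_notMem_Flips (by omega) (hb ▸ hc)).elim
  case e.x => exact (shift_ne_idem hn _ (hc.symm.trans hb)).elim
  case e.y => exact (shift_symm_ne_idem hn _ (hc.symm.trans hb)).elim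
  case e.e i hi j hj =>
    obtain rfl := eq_of_idem_eq hj (hb.symm.trans hc)
    rfl
  case e.xs i hi j hj => exact (idem_notMem_Flips (by omega) (hb ▸ hc)).elim
  case e.ys i hi j hj => exact (idem_notMem_Flips (by omega) (hb ▸ hc)).elim
  case xs.x i hi => exact (shift_notMem_Flips (by omega) (hc ▸ hb)).elim
  case xs.y i hi => exact (shift_symm_notMem_Flips (by omega) (hc ▸ hb)).elim
  case xs.e i hi j hj => exact (idem_notMem_Flips (by omega) (hc ▸ hb)).elim
  case xs.xs i hi j hj =>
    have := eq_of_mem_Flips h (by omega) (by omega) (by omega) hb hc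
    obtain rfl : i = j := by omega
    rfl
  case xs.ys i hi j hj =>
    have := eq_of_mem_Flips h (by omega) (by omega) (by omega) hb hc
    omega
  case ys.x i hi => exact (shift_notMem_Flips (by omega) (hc ▸ hb)).elim
  case ys.y i hi => exact (shift_symm_notMem_Flips (by omega) (hc ▸ hb)).elim
  case ys.e i hi j hj => exact (idem_notMem_Flips (by omega) (hc ▸ hb)).elim
  case ys.xs i hi j hj =>
    have := eq_of_mem_Flips h (by omega) (by omega) (by omega) hb hc
    omega
  case ys.ys i hi j hj =>
    have := eq_of_mem_Flips h (by omega) (by omega) (by omega) hb hc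
    obtain rfl : i = j := by omega
    rfl

theorem gen_injective (hn : 4 ≤ n) : Function.Injective (gen n) := fun b c h =>
  primeSet_disjoint hn (gen_mem_ODI b) (gen_mem_primeSet b) (h ▸ gen_mem_primeSet c)

/-- An element of `ODI n` with three points in its domain is a restriction of a translation. -/
theorem exists_translation {α : SymInv n} (h : α ∈ ODI n) {a b c a' b' c' : ℤ} (ha : Maps α a a')
    (hb : Maps α b b') (hc : Maps α c c') (hab : a < b) (hbc : b < c) :
    ∃ k : ℤ, ∀ a b, Maps α a b → b = a + k := by
  rcases ODI_cases h with h | ⟨p, q, p', q', -, -, -, -, -, hall⟩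
  · exact h
  · have := hall _ _ ha
    have := hall _ _ hb
    have := hall _ _ hc
    omega

theorem eq_shift {α : SymInv n} (hn : 4 ≤ n) (h : α ∈ ODI n)
    (hα : ∀ a : ℤ, 0 ≤ a → a + 1 < n → Maps α a (a + 1)) : α = shift n := by
  refine ext_maps fun a b => ?_
  rw [maps_shift]
  constructor
  · intro hab
    have hb := hab.bounds
    -- the last point would have to go beyond the chain
    have ha : a + 1 < n := by
      by_contra hlast
      have h1 := hα (a - 1) (by omega) (by omega)
      have := lt_of_mem_POI h.2 h1 hab (by omega)
      omega
    exact ⟨hab.right_unique (hα a hb.1 ha), hb.1, hb.2.2.2⟩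
  · rintro ⟨rfl, h0, h1⟩
    exact hα a h0 h1

theorem eq_shift_or_eq_shift (hn : 4 ≤ n) {α β : SymInv n} (hα : α ∈ ODI n) (hβ : β ∈ ODI n)
    (h : α * β = shift n) : α = shift n ∨ β = shift n := by
  have hM (a : ℤ) (h0 : 0 ≤ a) (h1 : a + 1 < n) : ∃ c, Maps α a c ∧ Maps β c (a + 1) := by
    rw [← maps_mul, h, maps_shift]
    exact ⟨rfl, h0, h1⟩
  obtain ⟨c₀, h₀, -⟩ := hM 0 (by omega) (by omega)
  obtain ⟨c₁, h₁, -⟩ := hM 1 (by omega) (by omega)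
  obtain ⟨c₂, h₂, -⟩ := hM (n - 2) (by omega) (by omega)
  obtain ⟨k, hk⟩ := exists_translation hα h₀ h₁ h₂ (by omega) (by omega)
  have := hk _ _ h₀
  have := hk _ _ h₂
  have := h₀.bounds
  have := h₂.bounds
  obtain rfl | rfl : k = 0 ∨ k = 1 := by omega
  · right
    refine eq_shift hn hβ fun a h0 h1 => ?_
    obtain ⟨c, hc, hc'⟩ := hM a h0 h1
    have := hk _ _ hc
    rwa [this, add_zero] at hc'
  · left
    refine eq_shift hn hα fun a h0 h1 => ?_
    obtain ⟨c, hc, hc'⟩ := hM a h0 h1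
    rwa [← hk _ _ hc]

theorem eq_idem_or_eq_idem (hn : 4 ≤ n) {i : ℕ} (hi : 2 ≤ i ∧ i ≤ n - 1) {α β : SymInv n}
    (hα : α ∈ ODI n) (h : α * β = idem n i) : α = idem n i ∨ β = idem n i := by
  have hM (a : ℤ) (h0 : 0 ≤ a) (h1 : a < n) (h2 : a + 1 ≠ i) : ∃ c, Maps α a c ∧ Maps β c a := by
    rw [← maps_mul, h, maps_idem]
    exact ⟨rfl, h0, h1, h2⟩
  obtain ⟨c₀, h₀, -⟩ := hM 0 (by omega) (by omega) (by omega)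
  obtain ⟨c₁, h₁, -⟩ := hM (if i = 2 then 2 else 1) (by split_ifs <;> omega)
    (by split_ifs <;> omega) (by split_ifs <;> omega)
  obtain ⟨c₂, h₂, -⟩ := hM (n - 1) (by omega) (by omega) (by omega)
  obtain ⟨k, hk⟩ := exists_translation hα h₀ h₁ h₂ (by split_ifs <;> omega)
    (by split_ifs <;> omega)
  have := hk _ _ h₀
  have := hk _ _ h₂
  have := h₀.bounds
  have := h₂.bounds
  obtain rfl : k = 0 := by omega
  have hdef (a : ℤ) (h0 : 0 ≤ a) (h1 : a < n) (h2 : a + 1 ≠ i) : Maps α a a := by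
    obtain ⟨c, hc, -⟩ := hM a h0 h1 h2
    have := hk _ _ hc
    rwa [this, add_zero] at hc
  by_cases hlast : Maps α (i - 1) (i - 1)
  · right
    have : α = 1 := by
      refine ext_maps fun a b => ?_
      rw [maps_one]
      constructor
      · intro hab
        have hb := hab.bounds
        have := hk _ _ hab
        exact ⟨by omega, hb.1, hb.2.1⟩
      · rintro ⟨rfl, h0, h1⟩
        by_cases h2 : a + 1 = i
        · rwa [show a = i - 1 by omega]
        · exact hdef a h0 h1 h2
    rwa [this, one_mul] at h
  · left
    refine ext_maps fun a b => ?_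
    rw [maps_idem]
    constructor
    · intro hab
      have hb := hab.bounds
      have := hk _ _ hab
      obtain rfl : b = a := by omega
      refine ⟨rfl, hb.1, hb.2.1, fun h2 => hlast ?_⟩
      rwa [← h2, add_sub_cancel_right]
    · rintro ⟨rfl, h0, h1, h2⟩
      exact hdef a h0 h1 h2

theorem mem_Flips_or_mem_Flips {α β : SymInv n} (hα : α ∈ ODI n) {d : ℤ} (hd : 0 < d)
    (h : α * β ∈ Flips n d) : α ∈ Flips n d ∨ β ∈ Flips n d := by
  obtain ⟨a, a', b, b', ha, hb, h3, h4⟩ := h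
  obtain ⟨e, hae, hea⟩ := maps_mul.1 ha
  obtain ⟨f, hbf, hfb⟩ := maps_mul.1 hb
  rcases ODI_cases hα with ⟨c, hc⟩ | ⟨p, q, p', q', hlt, -, hpq, hp, hq, hall⟩
  · have := hc _ _ hae
    have := hc _ _ hbf
    exact .inr ⟨_, _, _, _, hea, hfb, by omega, h4⟩
  · have := hall _ _ hae
    have := hall _ _ hbf
    obtain rfl : a = p := by omega
    obtain rfl : b = q := by omega
    have := hae.right_unique hp
    have := hbf.right_unique hq
    exact .inl ⟨_, _, _, _, hae, hbf, h3, by omega⟩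

theorem symm_mul {α β : SymInv n} : (α * β).symm = β.symm * α.symm := rfl

theorem primeSet_mul (hn : 4 ≤ n) {α β : SymInv n} (hα : α ∈ ODI n) (hβ : β ∈ ODI n)
    {b : Letter n} (h : α * β ∈ primeSet n b) : α ∈ primeSet n b ∨ β ∈ primeSet n b := by
  cases b with
  | x => exact eq_shift_or_eq_shift hn hα hβ h
  | y =>
    have h : α * β = (shift n).symm := h
    have := eq_shift_or_eq_shift hn (symm_mem_ODI hβ) (symm_mem_ODI hα)
      (by rw [← symm_mul, h, PEquiv.symm_symm])
    rcases this with h | h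
    · exact .inr (by rw [primeSet, Set.mem_singleton_iff, ← h, PEquiv.symm_symm])
    · exact .inl (by rw [primeSet, Set.mem_singleton_iff, ← h, PEquiv.symm_symm])
  | e i hi => exact eq_idem_or_eq_idem hn hi hα h
  | xs i hi => exact mem_Flips_or_mem_Flips hα (by omega) h
  | ys i hi => exact mem_Flips_or_mem_Flips hα (by omega) h

theorem one_notMem_primeSet (hn : 4 ≤ n) (b : Letter n) : 1 ∉ primeSet n b := by
  have hF {d : ℤ} (h2 : 2 * d ≠ n) : 1 ∉ Flips n d := by
    rintro ⟨a, a', b, b', ha, hb, h3, h4⟩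
    rw [maps_one] at ha hb
    omega
  have h0 : Maps (1 : SymInv n) 0 0 := maps_one.2 (by omega)
  cases b with
  | x =>
    intro h
    rw [show (1 : SymInv n) = shift n from h, maps_shift] at h0
    omega
  | y =>
    intro h
    rw [show (1 : SymInv n) = (shift n).symm from h, maps_symm, maps_shift] at h0
    omega
  | e i hi =>
    intro h
    have h0 : Maps (1 : SymInv n) (i - 1) (i - 1) := maps_one.2 (by omega)
    rw [show (1 : SymInv n) = idem n i from h, maps_idem] at h0
    omega
  | xs i hi => exact hF (by omega)
  | ys i hi => exact hF (by omega)

/-- Every generating set of `ODI n` has at least as many elements as there are letters, since it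
meets each of the pairwise disjoint sets `primeSet n b`. -/
theorem encard_range_gen_le (hn : 4 ≤ n) {S : Set (SymInv n)} (hS : Submonoid.closure S = ODI n) :
    (Set.range (gen n)).encard ≤ S.encard := by
  have hmeet (b : Letter n) : ∃ s ∈ S, s ∈ primeSet n b := by
    by_contra! hb
    have hall : ∀ α ∈ Submonoid.closure S, α ∉ primeSet n b := by
      intro α hα
      induction hα using Submonoid.closure_induction with
      | mem α h => exact hb α h
      | one => exact one_notMem_primeSet hn b
      | mul α β hα hβ h1 h2 =>
        rw [hS] at hα hβ
        exact fun h => (primeSet_mul hn hα hβ h).elim h1 h2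
    exact hall _ (hS ▸ gen_mem_ODI b) (gen_mem_primeSet b)
  choose g hgS hg using hmeet
  have hinj : Function.Injective g := fun b c h =>
    primeSet_disjoint hn (hS ▸ Submonoid.subset_closure (hgS b)) (hg b) (h ▸ hg c)
  calc (Set.range (gen n)).encard = (Set.range g).encard := by
        rw [← Set.image_univ, ← Set.image_univ, (gen_injective hn).encard_image,
          hinj.encard_image]
    _ ≤ S.encard := Set.encard_le_encard (by rintro _ ⟨b, rfl⟩; exact hgS b)

/-! ### Restrictions of translations in the presented monoid -/

/-- The monoid presented by `⟨B ∣ V⟩`. -/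
abbrev Pres (n : ℕ) : Type := PresentedMonoid (fun u v : Word n => (u, v) ∈ V n)

/-- The class of a word in the presented monoid. -/
def cls : Word n →* Pres n := PresentedMonoid.mk _

theorem cls_eq {u v : Word n} (h : Rel n u v) : cls u = cls v :=
  PresentedMonoid.mk_eq_mk_of_rel h

/-- The homomorphism from the presented monoid to partial permutations which sends each letter to
the partial permutation it denotes. -/
def sem (hn : 4 ≤ n) : Pres n →* SymInv n :=
  PresentedMonoid.lift (gen n) fun _ _ h => Rel.eval_eq hn h

theorem sem_cls (hn : 4 ≤ n) (w : Word n) : sem hn (cls w) = eval n w := rfl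

/-- The class of the letter `x`. -/
def px : Pres n := cls Word.x

/-- The class of the letter `y`. -/
def py : Pres n := cls Word.y

/-- The idempotent of the presented monoid standing for the identity map with the point of value
`j` removed. The letters `e_i` only remove inner points: the first point is removed by `y x` and the
last one by `x y`. For `n ≤ j` there is nothing to remove, and `pf j = 1`. -/
def pf (j : ℕ) : Pres n :=
  if j = 0 then py * px else if j + 1 = n then px * py else cls (Word.e (j + 1))

theorem pf_zero : (pf 0 : Pres n) = py * px := if_pos rfl

theorem pf_last (hn : 4 ≤ n) : (pf (n - 1) : Pres n) = px * py := by
  rw [pf, if_neg (by omega), if_pos (by omega)]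

theorem pf_inner {j : ℕ} (h0 : j ≠ 0) (h1 : j + 1 ≠ n) :
    (pf j : Pres n) = cls (Word.e (j + 1)) := by
  rw [pf, if_neg h0, if_neg h1]

theorem cls_e {i : ℕ} (h : 2 ≤ i ∧ i ≤ n - 1) : (cls (Word.e i) : Pres n) = pf (i - 1) := by
  rw [pf_inner (by omega) (by omega), show i - 1 + 1 = i by omega]

theorem cls_e_eq_one {i : ℕ} (h : ¬(2 ≤ i ∧ i ≤ n - 1)) : (cls (Word.e i) : Pres n) = 1 := by
  rw [Word.e, dif_neg h, map_one]

theorem pf_eq_one (hn : 4 ≤ n) {j : ℕ} (h : n ≤ j) : (pf j : Pres n) = 1 := by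
  rw [pf_inner (by omega) (by omega), cls_e_eq_one (by omega)]

theorem px_py_px : (px * py * px : Pres n) = px := by
  simpa [px, py] using cls_eq (Rel.v2_x (n := n))

theorem py_px_py : (py * px * py : Pres n) = py := by
  simpa [px, py] using cls_eq (Rel.v2_y (n := n))

theorem pf_comm (i j : ℕ) : (pf i * pf j : Pres n) = pf j * pf i := by
  have hend : Commute (py * px : Pres n) (px * py) := by
    have := cls_eq (Rel.v3 (n := n))
    simp only [map_mul, pow_two] at this
    simp only [Commute, SemiconjBy, ← mul_assoc] at this ⊢
    exact this
  have hyx (i : ℕ) : Commute (py * px : Pres n) (cls (Word.e i)) := by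
    by_cases h : 2 ≤ i ∧ i ≤ n - 1
    · have := cls_eq (Rel.v5_yx i h)
      simp only [map_mul] at this
      exact this
    · rw [cls_e_eq_one h]
      exact Commute.one_right _
  have hxy (i : ℕ) : Commute (px * py : Pres n) (cls (Word.e i)) := by
    by_cases h : 2 ≤ i ∧ i ≤ n - 1
    · have := cls_eq (Rel.v5_xy i h)
      simp only [map_mul] at this
      exact this
    · rw [cls_e_eq_one h]
      exact Commute.one_right _
  have hlt (i j : ℕ) (hij : i < j) : Commute (cls (Word.e i) : Pres n) (cls (Word.e j)) := by
    by_cases hi : 2 ≤ i ∧ i ≤ n - 1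
    · by_cases hj : 2 ≤ j ∧ j ≤ n - 1
      · have := cls_eq (Rel.v4 i j ⟨hi.1, hij, hj.2⟩)
        simp only [map_mul] at this
        exact this
      · rw [cls_e_eq_one hj]
        exact Commute.one_right _
    · rw [cls_e_eq_one hi]
      exact Commute.one_left _
  have hee (i j : ℕ) : Commute (cls (Word.e i) : Pres n) (cls (Word.e j)) := by
    rcases lt_trichotomy i j with h | rfl | h
    · exact hlt i j h
    · exact Commute.refl _
    · exact (hlt j i h).symm
  change Commute (pf i : Pres n) (pf j)
  unfold pf
  split_ifs
  · exact Commute.refl _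
  · exact hend
  · exact hyx _
  · exact hend.symm
  · exact Commute.refl _
  · exact hxy _
  · exact (hyx _).symm
  · exact (hxy _).symm
  · exact hee _ _

theorem pf_mul_self (j : ℕ) : (pf j * pf j : Pres n) = pf j := by
  unfold pf
  split_ifs
  · rw [← mul_assoc, py_px_py]
  · rw [← mul_assoc, px_py_px]
  · by_cases h : 2 ≤ j + 1 ∧ j + 1 ≤ n - 1
    · simpa using cls_eq (Rel.v1 _ h)
    · rw [cls_e_eq_one h, one_mul]

theorem px_mul_pf_succ (hn : 4 ≤ n) {j : ℕ} (h : j + 1 < n) :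
    (px * pf (j + 1) : Pres n) = pf j * px := by
  obtain rfl | h0 := eq_or_ne j 0
  · have := cls_eq (Rel.v7_y (n := n))
    simp only [map_mul, pow_two, ← mul_assoc] at this
    rw [pf_inner (by omega) (by omega), pf_zero]
    exact this.symm
  · obtain h1 | h1 := eq_or_ne (j + 2) n
    · have := cls_eq (Rel.v7_x (n := n))
      simp only [map_mul, pow_two] at this
      rw [cls_e (by omega), show n - 1 - 1 = j by omega] at this
      rw [show j + 1 = n - 1 by omega, pf_last hn, ← mul_assoc]
      exact this
    · have := cls_eq (Rel.v6 (n := n) (j + 1) (by omega))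
      simp only [map_mul] at this
      rw [pf_inner (by omega) (by omega), pf_inner (by omega) (by omega)]
      exact this

theorem px_mul_pf_zero : (px * pf 0 : Pres n) = px := by
  rw [pf_zero, ← mul_assoc, px_py_px]

theorem pf_last_mul_px (hn : 4 ≤ n) : (pf (n - 1) * px : Pres n) = px := by
  rw [pf_last hn, px_py_px]

theorem pf_zero_mul_py : (pf 0 * py : Pres n) = py := by
  rw [pf_zero, py_px_py]

theorem py_mul_pf_last (hn : 4 ≤ n) : (py * pf (n - 1) : Pres n) = py := by
  rw [pf_last hn, ← mul_assoc, py_px_py]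

theorem py_mul_pf (hn : 4 ≤ n) {j : ℕ} (h : j + 1 < n) :
    (py * pf j : Pres n) = pf (j + 1) * py := by
  calc (py * pf j : Pres n) = py * (pf (n - 1) * pf j) := by
        rw [← mul_assoc, py_mul_pf_last hn]
    _ = py * (pf j * px) * py := by rw [pf_comm, pf_last hn]; simp only [mul_assoc]
    _ = pf 0 * pf (j + 1) * py := by rw [← px_mul_pf_succ hn h, pf_zero]; simp only [mul_assoc]
    _ = pf (j + 1) * py := by rw [pf_comm, mul_assoc, pf_zero_mul_py]

theorem px_pow_mul_pf_of_lt (hn : 4 ≤ n) {k j : ℕ} (hj : j < n) (h : j < k) :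
    (px ^ k * pf j : Pres n) = px ^ k := by
  induction k generalizing j with
  | zero => omega
  | succ k ih =>
    rw [pow_succ, mul_assoc]
    cases j with
    | zero => rw [px_mul_pf_zero]
    | succ j => rw [px_mul_pf_succ hn hj, ← mul_assoc, ih (by omega) (by omega)]

theorem px_pow_mul_pf_of_le (hn : 4 ≤ n) {k j : ℕ} (hj : j < n) (h : k ≤ j) :
    (px ^ k * pf j : Pres n) = pf (j - k) * px ^ k := by
  induction k generalizing j with
  | zero => simp
  | succ k ih =>
    obtain ⟨j, rfl⟩ : ∃ i, j = i + 1 := ⟨j - 1, by omega⟩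
    rw [pow_succ, mul_assoc, px_mul_pf_succ hn hj, ← mul_assoc, ih (by omega) (by omega),
      mul_assoc, Nat.add_sub_add_right]

theorem pf_mul_px_pow_of_le (hn : 4 ≤ n) {k j : ℕ} (h : n ≤ j + k) :
    (pf j * px ^ k : Pres n) = px ^ k := by
  obtain hj | hj := le_or_gt n j
  · rw [pf_eq_one hn hj, one_mul]
  induction k generalizing j with
  | zero => omega
  | succ k ih =>
    rw [pow_succ', ← mul_assoc]
    obtain h1 | h1 := eq_or_ne (j + 1) n
    · rw [show j = n - 1 by omega, pf_last_mul_px hn]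
    · rw [← px_mul_pf_succ hn (by omega), mul_assoc, ih (by omega) (by omega)]

theorem py_pow_mul_pf_of_le (hn : 4 ≤ n) {k j : ℕ} (h : n ≤ j + k) :
    (py ^ k * pf j : Pres n) = py ^ k := by
  obtain hj | hj := le_or_gt n j
  · rw [pf_eq_one hn hj, mul_one]
  induction k generalizing j with
  | zero => omega
  | succ k ih =>
    rw [pow_succ, mul_assoc]
    obtain h1 | h1 := eq_or_ne (j + 1) n
    · rw [show j = n - 1 by omega, py_mul_pf_last hn]
    · rw [py_mul_pf hn (by omega), ← mul_assoc, ih (by omega) (by omega)]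

theorem py_pow_mul_pf_of_lt (hn : 4 ≤ n) {k j : ℕ} (h : j + k < n) :
    (py ^ k * pf j : Pres n) = pf (j + k) * py ^ k := by
  induction k generalizing j with
  | zero => simp
  | succ k ih =>
    rw [pow_succ, mul_assoc, py_mul_pf hn (by omega), ← mul_assoc, ih (by omega), mul_assoc,
      add_right_comm, add_assoc]

theorem pf_mul_py_pow_of_lt (hn : 4 ≤ n) {k j : ℕ} (h : j < k) :
    (pf j * py ^ k : Pres n) = py ^ k := by
  obtain hj | hj := le_or_gt n j
  · rw [pf_eq_one hn hj, one_mul]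
  induction k generalizing j with
  | zero => omega
  | succ k ih =>
    rw [pow_succ', ← mul_assoc]
    cases j with
    | zero => rw [pf_zero_mul_py]
    | succ j => rw [← py_mul_pf hn hj, mul_assoc, ih (by omega) (by omega)]

/-- The product of the idempotents `pf j` with `j ∈ l`, which stands for the identity map with the
points of `l` removed. As the factors are commuting idempotents, it depends only on the set of
points in `l`. -/
def pfs (l : List ℕ) : Pres n := (l.map pf).prod

@[simp] theorem pfs_nil : (pfs [] : Pres n) = 1 := rfl

theorem pfs_cons (j : ℕ) (l : List ℕ) : (pfs (j :: l) : Pres n) = pf j * pfs l := by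
  simp [pfs]

theorem pfs_singleton (j : ℕ) : (pfs [j] : Pres n) = pf j := by
  simp [pfs]

theorem pfs_append (l l' : List ℕ) : (pfs (l ++ l') : Pres n) = pfs l * pfs l' := by
  simp [pfs]

theorem pf_mul_pfs_comm (j : ℕ) (l : List ℕ) : (pf j * pfs l : Pres n) = pfs l * pf j := by
  induction l with
  | nil => simp
  | cons i l ih => rw [pfs_cons, ← mul_assoc, pf_comm, mul_assoc, ih, mul_assoc]

theorem pf_mul_pfs_of_mem {j : ℕ} {l : List ℕ} (h : j ∈ l) : (pf j * pfs l : Pres n) = pfs l := by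
  induction l with
  | nil => simp at h
  | cons i l ih =>
    rw [pfs_cons]
    rcases List.mem_cons.1 h with rfl | h
    · rw [← mul_assoc, pf_mul_self]
    · rw [← mul_assoc, pf_comm, mul_assoc, ih h]

theorem pfs_mul_eq_self {m : Pres n} {l : List ℕ} (h : ∀ j ∈ l, pf j * m = m) : pfs l * m = m := by
  induction l with
  | nil => simp
  | cons i l ih =>
    rw [pfs_cons, mul_assoc, ih fun j hj => h j (List.mem_cons_of_mem i hj),
      h i List.mem_cons_self]

/-- The element `x ^ k` or `y ^ (-k)`, according to the sign of `k`, which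
stands for the translation by `k`. -/
def pshift (k : ℤ) : Pres n := px ^ k.toNat * py ^ (-k).toNat

theorem pshift_natCast (k : ℕ) : (pshift k : Pres n) = px ^ k := by
  simp [pshift]

theorem pshift_neg_natCast (k : ℕ) : (pshift (-k) : Pres n) = py ^ k := by
  simp [pshift]

theorem pf_mul_pshift (hn : 4 ≤ n) {j : ℕ} {k : ℤ} (h : j + k < 0 ∨ n ≤ j + k) :
    (pf j * pshift k : Pres n) = pshift k := by
  obtain ⟨k, rfl | rfl⟩ := k.eq_nat_or_neg
  · rw [pshift_natCast, pf_mul_px_pow_of_le hn (by omega)]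
  · rw [pshift_neg_natCast]
    obtain hj | hj := lt_or_ge j k
    · rw [pf_mul_py_pow_of_lt hn hj]
    · rw [pf_eq_one hn (by omega), one_mul]

/-- The submonoid of the presented monoid that stands for the restrictions of translations. -/
def transl (n : ℕ) : Submonoid (Pres n) := Submonoid.closure ({px, py} ∪ Set.range pf)

theorem px_mem : px ∈ transl n := Submonoid.subset_closure (by simp)

theorem py_mem : py ∈ transl n := Submonoid.subset_closure (by simp)

theorem pf_mem (j : ℕ) : pf j ∈ transl n := Submonoid.subset_closure (by simp)

theorem pfs_mem (l : List ℕ) : pfs l ∈ transl n :=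
  Submonoid.list_prod_mem _ fun m hm => by
    obtain ⟨j, -, rfl⟩ := List.mem_map.1 hm
    exact pf_mem j

theorem exists_px_pow_mul_pf (hn : 4 ≤ n) (k j : ℕ) :
    ∃ l, (px ^ k * pf j : Pres n) = pfs l * px ^ k := by
  obtain hj | hj := le_or_gt n j
  · exact ⟨[], by rw [pf_eq_one hn hj, mul_one, pfs_nil, one_mul]⟩
  obtain h | h := lt_or_ge j k
  · exact ⟨[], by rw [px_pow_mul_pf_of_lt hn hj h, pfs_nil, one_mul]⟩
  · exact ⟨[j - k], by rw [px_pow_mul_pf_of_le hn hj h, pfs_singleton]⟩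

theorem exists_py_pow_mul_pf (hn : 4 ≤ n) (k j : ℕ) :
    ∃ l, (py ^ k * pf j : Pres n) = pfs l * py ^ k := by
  obtain h | h := lt_or_ge (j + k) n
  · exact ⟨[j + k], by rw [py_pow_mul_pf_of_lt hn h, pfs_singleton]⟩
  · exact ⟨[], by rw [py_pow_mul_pf_of_le hn h, pfs_nil, one_mul]⟩

/-- Every element of `transl n` is a product of idempotents followed by a translation. -/
theorem exists_eq_pfs_mul_pshift (hn : 4 ≤ n) {m : Pres n} (hm : m ∈ transl n) :
    ∃ l k, m = pfs l * pshift k := by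
  have key (k : ℤ) (g : Pres n) (hg : g ∈ ({px, py} ∪ Set.range pf : Set (Pres n))) :
      ∃ l k', pshift k * g = pfs l * pshift k' := by
    rcases hg with (rfl | rfl) | ⟨j, rfl⟩ <;> obtain ⟨k, rfl | rfl⟩ := k.eq_nat_or_neg
    · exact ⟨[], (k + 1 : ℕ), by rw [pshift_natCast, pshift_natCast, pow_succ, pfs_nil, one_mul]⟩
    · cases k with
      | zero => exact ⟨[], (1 : ℕ), by rw [pshift_natCast]; simp [pshift]⟩
      | succ k =>
        obtain ⟨l, hl⟩ := exists_py_pow_mul_pf hn k 0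
        refine ⟨l, -k, ?_⟩
        rw [pshift_neg_natCast, pshift_neg_natCast, pow_succ, mul_assoc, ← pf_zero, hl]
    · cases k with
      | zero => exact ⟨[], -(1 : ℕ), by rw [pshift_neg_natCast]; simp [pshift]⟩
      | succ k =>
        obtain ⟨l, hl⟩ := exists_px_pow_mul_pf hn k (n - 1)
        refine ⟨l, k, ?_⟩
        rw [pshift_natCast, pshift_natCast, pow_succ, mul_assoc, ← pf_last hn, hl]
    · exact ⟨[], -(k + 1 : ℕ),
        by rw [pshift_neg_natCast, pshift_neg_natCast, pow_succ, pfs_nil, one_mul]⟩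
    · obtain ⟨l, hl⟩ := exists_px_pow_mul_pf hn k j
      exact ⟨l, k, by rw [pshift_natCast, hl]⟩
    · obtain ⟨l, hl⟩ := exists_py_pow_mul_pf hn k j
      exact ⟨l, -k, by rw [pshift_neg_natCast, hl]⟩
  induction hm using Submonoid.closure_induction_right with
  | one => exact ⟨[], 0, by simp [pshift]⟩
  | mul_right m _ g hg ih =>
    obtain ⟨l, k, rfl⟩ := ih
    obtain ⟨l', k', h⟩ := key k g hg
    exact ⟨l ++ l', k', by rw [mul_assoc, h, ← mul_assoc, pfs_append]⟩

theorem sem_px (hn : 4 ≤ n) : sem hn px = shift n := by rw [px, sem_cls, eval_x]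

theorem sem_py (hn : 4 ≤ n) : sem hn py = (shift n).symm := by rw [py, sem_cls, eval_y]

theorem maps_mul_sem_pf (hn : 4 ≤ n) {α : SymInv n} {j : ℕ} {a b : ℤ} :
    Maps (α * sem hn (pf j)) a b ↔ Maps α a b ∧ b ≠ j := by
  obtain hj | hj := le_or_gt n j
  · rw [pf_eq_one hn hj, map_one, mul_one]
    exact ⟨fun h => ⟨h, by have := h.bounds; omega⟩, fun h => h.1⟩
  obtain rfl | h0 := eq_or_ne j 0
  · rw [pf_zero, map_mul, sem_px, sem_py, ← mul_assoc, maps_mul_shift, maps_mul_shift_symm,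
      sub_add_cancel]
    exact ⟨fun h => ⟨h.1.1, by omega⟩,
      fun h => by have := h.1.bounds; exact ⟨⟨h.1, by omega⟩, by omega⟩⟩
  obtain h1 | h1 := eq_or_ne (j + 1) n
  · rw [show j = n - 1 by omega, pf_last hn, map_mul, sem_px, sem_py, ← mul_assoc,
      maps_mul_shift_symm, maps_mul_shift, add_sub_cancel_right]
    exact ⟨fun h => ⟨h.1.1, by omega⟩,
      fun h => by have := h.1.bounds; exact ⟨⟨h.1, by omega⟩, by omega⟩⟩
  · rw [pf_inner h0 h1, sem_cls, eval_e (by omega), maps_mul_idem]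
    exact and_congr_right fun h => by omega

theorem maps_mul_sem_pfs (hn : 4 ≤ n) {α : SymInv n} {l : List ℕ} {a b : ℤ} :
    Maps (α * sem hn (pfs l)) a b ↔ Maps α a b ∧ ∀ j ∈ l, b ≠ j := by
  induction l generalizing α with
  | nil => simp
  | cons i l ih => rw [pfs_cons, map_mul, ← mul_assoc, ih, maps_mul_sem_pf]; simp [and_assoc]

theorem maps_mul_sem_pshift (hn : 4 ≤ n) {α : SymInv n} {k a b : ℤ} :
    Maps (α * sem hn (pshift k)) a b ↔ Maps α a (b - k) ∧ 0 ≤ b ∧ b < n := by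
  obtain ⟨k, rfl | rfl⟩ := k.eq_nat_or_neg
  · rw [pshift_natCast, map_pow, sem_px, maps_mul_shift_pow]
    exact and_congr_right fun h => by have := h.bounds; omega
  · rw [pshift_neg_natCast, map_pow, sem_py, maps_mul_shift_symm_pow, sub_neg_eq_add]
    exact and_congr_right fun h => by have := h.bounds; omega

theorem maps_sem_transl (hn : 4 ≤ n) {l : List ℕ} {k a b : ℤ} :
    Maps (sem hn (pfs l * pshift k)) a b ↔
      b = a + k ∧ 0 ≤ a ∧ a < n ∧ 0 ≤ b ∧ b < n ∧ ∀ j ∈ l, a ≠ j := by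
  rw [← one_mul (sem hn _), map_mul, ← mul_assoc, maps_mul_sem_pshift, maps_mul_sem_pfs, maps_one]
  constructor
  · rintro ⟨⟨⟨rfl, h0, h1⟩, h2⟩, h3, h4⟩
    exact ⟨by ring, h0, h1, h3, h4, h2⟩
  · rintro ⟨rfl, h0, h1, h3, h4, h2⟩
    rw [add_sub_cancel_right]
    exact ⟨⟨⟨rfl, h0, h1⟩, h2⟩, h3, h4⟩

/-- An element of `transl n` absorbs the idempotents of the points outside its domain. -/
theorem pf_mul_eq_self (hn : 4 ≤ n) {m : Pres n} (hm : m ∈ transl n) {j : ℕ}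
    (h : ∀ b, ¬Maps (sem hn m) j b) : pf j * m = m := by
  obtain ⟨l, k, rfl⟩ := exists_eq_pfs_mul_pshift hn hm
  by_cases hj : j ∈ l
  · rw [← mul_assoc, pf_mul_pfs_of_mem hj]
  obtain hjn | hjn := le_or_gt n j
  · rw [pf_eq_one hn hjn, one_mul]
  have := h (j + k)
  rw [maps_sem_transl] at this
  rw [← mul_assoc, pf_mul_pfs_comm, mul_assoc, pf_mul_pshift hn]
  by_contra hjk
  refine this ⟨rfl, by omega, by omega, by omega, by omega, fun i hi hji => hj ?_⟩
  rwa [Nat.cast_inj.1 hji]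

theorem pfs_mul_pfs_of_subset {l l' : List ℕ} (h : ∀ j ∈ l, j ∈ l') :
    (pfs l * pfs l' : Pres n) = pfs l' :=
  pfs_mul_eq_self fun j hj => pf_mul_pfs_of_mem (h j hj)

theorem pfs_comm (l l' : List ℕ) : (pfs l * pfs l' : Pres n) = pfs l' * pfs l := by
  induction l with
  | nil => simp
  | cons i l ih => rw [pfs_cons, mul_assoc, ih, ← mul_assoc, pf_mul_pfs_comm, mul_assoc]

theorem pfs_congr {l l' : List ℕ} (h : ∀ j, j ∈ l ↔ j ∈ l') : (pfs l : Pres n) = pfs l' := by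
  rw [← pfs_mul_pfs_of_subset (n := n) fun j hj => (h j).2 hj, pfs_comm,
    pfs_mul_pfs_of_subset fun j hj => (h j).1 hj]

theorem cls_es {a b : ℕ} (ha : 2 ≤ a) (hb : b ≤ n - 1) :
    (cls (Word.es a b) : Pres n) = pfs (List.range' (a - 1) (b + 1 - a)) := by
  obtain ⟨k, hk⟩ : ∃ k, k = b + 1 - a := ⟨_, rfl⟩
  unfold Word.es
  rw [← hk]
  induction k generalizing a with
  | zero => simp
  | succ k ih =>
    rw [List.range'_succ, List.map_cons, List.prod_cons, map_mul, ih (by omega) (by omega),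
      List.range'_succ, pfs_cons, cls_e (by omega), show a + 1 - 1 = a - 1 + 1 by omega]

theorem pfs_range'_mul_px (hn : 4 ≤ n) {a k : ℕ} (h : a + k < n) :
    (pfs (List.range' a k) * px : Pres n) = px * pfs (List.range' (a + 1) k) := by
  induction k generalizing a with
  | zero => simp
  | succ k ih =>
    rw [List.range'_succ, List.range'_succ, pfs_cons, pfs_cons, mul_assoc, ih (by omega),
      ← mul_assoc, ← px_mul_pf_succ hn (by omega), mul_assoc]

/-- The element `pfs (List.range n)`, which stands for the empty map, is a left zero of `x`. This is
where the relation `Rel.v8` enters. -/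
theorem pfs_range_mul_px (hn : 4 ≤ n) :
    (pfs (List.range n) * px : Pres n) = pfs (List.range n) := by
  have h0 : (pfs (List.range n) : Pres n) = pf 0 * pfs (List.range' 1 (n - 1)) := by
    rw [← pfs_cons]
    exact pfs_congr fun j => by simp; omega
  have h1 : (pfs (List.range n) : Pres n) = pfs (List.range' 0 (n - 1)) * pf (n - 1) := by
    rw [← pfs_singleton, ← pfs_append]
    exact pfs_congr fun j => by simp; omega
  have h2 : (pfs (List.range' 1 (n - 1)) : Pres n) = cls (Word.es 2 (n - 1)) * pf (n - 1) := by
    rw [cls_es le_rfl le_rfl, ← pfs_singleton, ← pfs_append]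
    exact pfs_congr fun j => by simp; omega
  have h8 : (pf 0 * pfs (List.range' 1 (n - 1)) : Pres n) = px * pfs (List.range' 1 (n - 1)) := by
    have := cls_eq (Rel.v8 (n := n))
    simp only [map_mul, mul_assoc] at this
    rw [h2, pf_zero, pf_last hn]
    simp only [mul_assoc]
    exact this
  calc (pfs (List.range n) * px : Pres n) = pfs (List.range' 0 (n - 1)) * px := by
        rw [h1, mul_assoc, pf_last_mul_px hn]
    _ = px * pfs (List.range' 1 (n - 1)) := pfs_range'_mul_px hn (by omega)
    _ = pfs (List.range n) := by rw [h0, h8]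

theorem pfs_range_mul_pshift (hn : 4 ≤ n) (k : ℤ) :
    (pfs (List.range n) * pshift k : Pres n) = pfs (List.range n) := by
  have hx := pfs_range_mul_px (n := n) hn
  have hy : (pfs (List.range n) * py : Pres n) = pfs (List.range n) := by
    rw [← hx, mul_assoc, ← pf_last hn, hx, ← pf_mul_pfs_comm]
    exact pf_mul_pfs_of_mem (List.mem_range.2 (by omega))
  have hpow {g : Pres n} (hg : pfs (List.range n) * g = pfs (List.range n)) (k : ℕ) :
      pfs (List.range n) * g ^ k = pfs (List.range n) := by
    induction k with
    | zero => simp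
    | succ k ih => rw [pow_succ', ← mul_assoc, hg, ih]
  rw [pshift, ← mul_assoc, hpow hx, hpow hy]

/-- Elements of `transl n` are determined by the partial permutations they stand for. -/
theorem transl_injOn (hn : 4 ≤ n) {m m' : Pres n} (hm : m ∈ transl n) (hm' : m' ∈ transl n)
    (h : sem hn m = sem hn m') : m = m' := by
  obtain ⟨l, k, hlk⟩ := exists_eq_pfs_mul_pshift hn hm
  obtain ⟨l', k', hlk'⟩ := exists_eq_pfs_mul_pshift hn hm'
  by_cases hempty : ∃ a b, Maps (sem hn m) a b
  · -- the translation is determined, and each side absorbs the idempotents of the other one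
    obtain ⟨a, b, hab⟩ := hempty
    have hab' := h ▸ hab
    rw [hlk, maps_sem_transl] at hab
    rw [hlk', maps_sem_transl] at hab'
    obtain rfl : k = k' := by omega
    have h1 : pfs l' * m = m := pfs_mul_eq_self fun j hj => pf_mul_eq_self hn hm fun b hb => by
      rw [h, hlk', maps_sem_transl] at hb
      exact hb.2.2.2.2.2 j hj rfl
    have h2 : pfs l * m' = m' := pfs_mul_eq_self fun j hj => pf_mul_eq_self hn hm' fun b hb => by
      rw [← h, hlk, maps_sem_transl] at hb
      exact hb.2.2.2.2.2 j hj rfl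
    rw [← h1, ← h2, hlk, hlk', ← mul_assoc, ← mul_assoc, pfs_comm]
  · have hzero {m : Pres n} {l k} (hm : m ∈ transl n) (hlk : m = pfs l * pshift k)
        (hempty : ¬∃ a b, Maps (sem hn m) a b) : m = pfs (List.range n) := by
      have h1 : pfs (List.range n) * m = m := pfs_mul_eq_self fun j _ =>
        pf_mul_eq_self hn hm fun b hb => hempty ⟨_, _, hb⟩
      have h2 (j : ℕ) (hj : j ∈ l) : (pf j * pfs (List.range n) : Pres n) = pfs (List.range n) := by
        obtain h | h := lt_or_ge j n
        · exact pf_mul_pfs_of_mem (List.mem_range.2 h)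
        · rw [pf_eq_one hn h, one_mul]
      rw [← h1, hlk, ← mul_assoc, pfs_comm, pfs_mul_eq_self h2, pfs_range_mul_pshift hn]
    rw [hzero hm hlk hempty, hzero hm' hlk' (h ▸ hempty)]

/-! ### The letters `x_i` and `y_i` in the presented monoid -/

/-- The class of the letter that stands for the map `0 ↦ 0`, `d ↦ n - d` between two-element sets of
points, for `0 < d < n` and `2 d ≠ n`: this is `x_d` if `2 d < n`, and `y_{n-d}` otherwise. -/
def pp (d : ℕ) : Pres n := if 2 * d < n then cls (Word.xs d) else cls (Word.ys (n - d))

theorem pp_of_lt {d : ℕ} (h : 2 * d < n) : (pp d : Pres n) = cls (Word.xs d) := if_pos h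

theorem pp_of_gt {d : ℕ} (h : n < 2 * d) : (pp d : Pres n) = cls (Word.ys (n - d)) :=
  if_neg (by omega)

theorem pp_sub {d : ℕ} (h0 : 0 < d) (h : 2 * d < n) : (pp (n - d) : Pres n) = cls (Word.ys d) := by
  rw [pp_of_gt (by omega), show n - (n - d) = d by omega]

theorem exists_eq_or_eq_sub {d : ℕ} (h0 : 0 < d) (h1 : d < n) (h2 : 2 * d ≠ n) :
    ∃ i, 1 ≤ i ∧ 2 * i < n ∧ (i = d ∨ d = n - i) := by
  obtain h | h := lt_or_gt_of_ne h2
  · exact ⟨d, by omega⟩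
  · exact ⟨n - d, by omega⟩

theorem cls_px_mul_py (hn : 4 ≤ n) : (cls (Word.x * Word.y) : Pres n) = pf (n - 1) := by
  rw [map_mul, pf_last hn, px, py]

theorem cls_py_mul_px : (cls (Word.y * Word.x) : Pres n) = pf 0 := by
  rw [map_mul, pf_zero, px, py]

theorem pf_mul_pp (hn : 4 ≤ n) {d : ℕ} (h0 : 0 < d) (h1 : d < n) (h2 : 2 * d ≠ n) {j : ℕ}
    (hj0 : j ≠ 0) (hjd : j ≠ d) : (pf j * pp d : Pres n) = pp d := by
  obtain hj | hj := le_or_gt n j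
  · rw [pf_eq_one hn hj, one_mul]
  obtain ⟨i, h3, h4, rfl | rfl⟩ := exists_eq_or_eq_sub h0 h1 h2
  · rw [pp_of_lt h4]
    obtain rfl | h5 := eq_or_ne j (n - 1)
    · rw [← cls_px_mul_py hn, ← map_mul]
      obtain rfl | h6 := eq_or_ne i 1
      · exact cls_eq .v12_x_one
      · exact cls_eq (.v12_x' i (by omega))
    · rw [pf_inner hj0 (by omega), ← map_mul]
      exact cls_eq (.v11_x i (j + 1) (by omega) (by omega))
  · rw [pp_sub h3 h4]
    obtain rfl | h5 := eq_or_ne j (n - 1)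
    · rw [← cls_px_mul_py hn, ← map_mul]
      exact (cls_eq (.v12_y i (by omega))).trans (cls_eq (.v12_y' i (by omega)))
    · rw [pf_inner hj0 (by omega), ← map_mul]
      exact cls_eq (.v10_y i (j + 1) (by omega) (by omega))

theorem pp_mul_pf (hn : 4 ≤ n) {d : ℕ} (h0 : 0 < d) (h1 : d < n) (h2 : 2 * d ≠ n) {j : ℕ}
    (hj0 : j ≠ 0) (hjd : j ≠ n - d) : (pp d * pf j : Pres n) = pp d := by
  obtain hj | hj := le_or_gt n j
  · rw [pf_eq_one hn hj, mul_one]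
  obtain ⟨i, h3, h4, rfl | rfl⟩ := exists_eq_or_eq_sub h0 h1 h2
  · rw [pp_of_lt h4]
    obtain rfl | h5 := eq_or_ne j (n - 1)
    · rw [← cls_px_mul_py hn, ← map_mul]
      exact (cls_eq (.v12_x i (by omega))).trans (cls_eq (.v12_x' i (by omega)))
    · rw [pf_inner hj0 (by omega), ← map_mul]
      exact cls_eq (.v10_x i (j + 1) (by omega) (by omega))
  · rw [pp_sub h3 h4]
    obtain rfl | h5 := eq_or_ne j (n - 1)
    · rw [← cls_px_mul_py hn, ← map_mul]
      obtain rfl | h6 := eq_or_ne i 1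
      · exact cls_eq .v12_y_one
      · exact cls_eq (.v12_y' i (by omega))
    · rw [pf_inner hj0 (by omega), ← map_mul]
      exact cls_eq (.v11_y i (j + 1) (by omega) (by omega))

theorem cls_x_mem : cls Word.x ∈ transl n := px_mem

theorem cls_y_mem : cls Word.y ∈ transl n := py_mem

theorem cls_e_mem (i : ℕ) : cls (Word.e i) ∈ transl n := by
  by_cases h : 2 ≤ i ∧ i ≤ n - 1
  · rw [cls_e h]
    exact pf_mem _
  · rw [cls_e_eq_one h]
    exact one_mem _

theorem cls_es_mem (a b : ℕ) : cls (Word.es a b) ∈ transl n := by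
  rw [Word.es, map_list_prod]
  refine Submonoid.list_prod_mem _ fun m hm => ?_
  simp only [List.map_map, List.mem_map, Function.comp_apply] at hm
  obtain ⟨i, -, rfl⟩ := hm
  exact cls_e_mem i

theorem cls_es_mul_xy_mem (a b : ℕ) : cls (Word.es a b * (Word.x * Word.y)) ∈ transl n := by
  simp only [map_mul]
  exact mul_mem (cls_es_mem _ _) (mul_mem cls_x_mem cls_y_mem)

theorem cls_xs_one_mul_yx_mem : cls (Word.xs 1 * (Word.y * Word.x)) ∈ transl n := by
  rw [cls_eq .v13_x_one']
  simp only [map_mul, map_pow]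
  exact mul_mem (pow_mem cls_x_mem _) (cls_e_mem _)

theorem cls_xs_mul_yx_mem {i : ℕ} (h : 1 ≤ i ∧ i ≤ (n - 1) / 2) :
    cls (Word.xs i * (Word.y * Word.x)) ∈ transl n := by
  obtain rfl | h1 := eq_or_ne i 1
  · exact cls_xs_one_mul_yx_mem
  rw [cls_eq (.v13_x' i (by omega))]
  simp only [map_mul, map_pow]
  exact mul_mem (mul_mem (mul_mem (pow_mem cls_x_mem _) (cls_es_mem _ _)) (cls_es_mem _ _))
    (mul_mem cls_x_mem cls_y_mem)

theorem cls_ys_mul_yx_mem {i : ℕ} (h : 1 ≤ i ∧ i ≤ (n - 1) / 2) :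
    cls (Word.ys i * (Word.y * Word.x)) ∈ transl n := by
  rw [cls_eq (.v13_y' i h)]
  simp only [map_mul, map_pow]
  exact mul_mem (mul_mem (mul_mem (pow_mem cls_y_mem _) cls_x_mem) (cls_es_mem _ _))
    (cls_es_mem _ _)

theorem pf_mul_pp_mem (hn : 4 ≤ n) {d : ℕ} (h0 : 0 < d) (h1 : d < n) (h2 : 2 * d ≠ n) {j : ℕ}
    (hj : j = 0 ∨ j = d) : pf j * pp d ∈ transl n := by
  rcases hj with rfl | rfl
  · obtain ⟨i, h3, h4, rfl | rfl⟩ := exists_eq_or_eq_sub h0 h1 h2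
    · rw [pp_of_lt h4, ← cls_py_mul_px, ← map_mul]
      obtain rfl | h5 := eq_or_ne i 1
      · rw [cls_eq .v13_x_one]
        exact cls_xs_mul_yx_mem (by omega)
      · rw [cls_eq (.v13_x i (by omega))]
        exact cls_xs_mul_yx_mem (by omega)
    · rw [pp_sub h3 h4, ← cls_py_mul_px, ← map_mul, cls_eq (.v13_y i (by omega))]
      exact cls_ys_mul_yx_mem (by omega)
  · obtain ⟨i, h3, h4, rfl | rfl⟩ := exists_eq_or_eq_sub h0 h1 h2
    · rw [pp_of_lt h4, pf_inner (by omega) (by omega), ← map_mul]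
      obtain rfl | h5 := eq_or_ne i 1
      · rw [cls_eq .v14_one', cls_eq .v14_one'', cls_eq .v14_one''']
        exact cls_es_mul_xy_mem _ _
      · rw [cls_eq (.v14' i (by omega)), cls_eq (.v14'' i (by omega)),
          cls_eq (.v14''' i (by omega))]
        exact cls_es_mul_xy_mem _ _
    · rw [pp_sub h3 h4]
      obtain rfl | h5 := eq_or_ne i 1
      · rw [← cls_px_mul_py hn, ← map_mul, cls_eq .v14_one''']
        exact cls_es_mul_xy_mem _ _
      · rw [pf_inner (by omega) (by omega), ← map_mul, cls_eq (.v14''' i (by omega))]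
        exact cls_es_mul_xy_mem _ _

theorem pp_mul_pf_mem (hn : 4 ≤ n) {d : ℕ} (h0 : 0 < d) (h1 : d < n) (h2 : 2 * d ≠ n) {j : ℕ}
    (hj : j = 0 ∨ j = n - d) : pp d * pf j ∈ transl n := by
  obtain ⟨i, h3, h4, rfl | rfl⟩ := exists_eq_or_eq_sub h0 h1 h2
  · rw [pp_of_lt h4]
    rcases hj with rfl | rfl
    · rw [← cls_py_mul_px, ← map_mul]
      exact cls_xs_mul_yx_mem (by omega)
    · obtain rfl | h5 := eq_or_ne i 1
      · rw [← cls_px_mul_py hn, ← map_mul, cls_eq .v14_one, cls_eq .v14_one', cls_eq .v14_one'',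
          cls_eq .v14_one''']
        exact cls_es_mul_xy_mem _ _
      · rw [pf_inner (by omega) (by omega), ← map_mul, cls_eq (.v14 i (by omega)),
          cls_eq (.v14' i (by omega)), cls_eq (.v14'' i (by omega)), cls_eq (.v14''' i (by omega))]
        exact cls_es_mul_xy_mem _ _
  · rw [pp_sub h3 h4]
    rcases hj with rfl | rfl
    · rw [← cls_py_mul_px, ← map_mul]
      exact cls_ys_mul_yx_mem (by omega)
    · rw [show n - (n - i) = i by omega, pf_inner (by omega) (by omega), ← map_mul]
      obtain rfl | h5 := eq_or_ne i 1
      · rw [cls_eq .v14_one'', cls_eq .v14_one''']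
        exact cls_es_mul_xy_mem _ _
      · rw [cls_eq (.v14'' i (by omega)), cls_eq (.v14''' i (by omega))]
        exact cls_es_mul_xy_mem _ _

theorem pp_mul_pp_mem {d : ℕ} (h0 : 0 < d) (h1 : d < n) (h2 : 2 * d ≠ n) :
    pp d * pp (n - d) ∈ transl n := by
  obtain ⟨i, h3, h4, rfl | rfl⟩ := exists_eq_or_eq_sub h0 h1 h2
  · rw [pp_of_lt h4, pp_sub h3 h4, ← map_mul, cls_eq (.v9_xy i (by omega))]
    simp only [map_mul]
    exact mul_mem (mul_mem (cls_es_mem _ _) (cls_es_mem _ _)) (mul_mem cls_x_mem cls_y_mem)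
  · rw [show n - (n - i) = i by omega, pp_of_lt h4, pp_sub h3 h4, ← map_mul]
    obtain rfl | h5 := eq_or_ne i 1
    · rw [cls_eq .v9_yx_one]
      exact cls_es_mem _ _
    · rw [cls_eq (.v9_yx i (by omega))]
      simp only [map_mul]
      exact mul_mem (mul_mem (cls_es_mem _ _) (cls_es_mem _ _)) (mul_mem cls_x_mem cls_y_mem)

theorem maps_mul_sem_pp (hn : 4 ≤ n) {d : ℕ} (h0 : 0 < d) (h1 : d < n) (h2 : 2 * d ≠ n)
    {α : SymInv n} {a b : ℤ} :
    Maps (α * sem hn (pp d)) a b ↔ b = 0 ∧ Maps α a 0 ∨ b = n - d ∧ Maps α a d := by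
  obtain ⟨i, h3, h4, rfl | rfl⟩ := exists_eq_or_eq_sub h0 h1 h2
  · rw [pp_of_lt h4, sem_cls, eval_xs (by omega), maps_mul_pair]
  · rw [pp_sub h3 h4, sem_cls, eval_ys (by omega), maps_mul_pair_symm,
      Nat.cast_sub (by omega), sub_sub_cancel]

/-! ### Normal forms -/

/-- The parameters for which there is an order-preserving map between two-element sets of points
sending `a` to `c` and `a + d` to `c + (n - d)` and which is not a restriction of a translation;
`im` says that `c + (n - d) < n`. -/
structure FlipParams (n d a c : ℕ) : Prop where
  pos : 0 < d
  lt : d < n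
  ne : 2 * d ≠ n
  dom : a + d < n
  im : c < d

/-- The element of the presented monoid that stands for the map `a ↦ c`, `a + d ↦ c + (n - d)`. -/
def pflip (d a c : ℕ) : Pres n := py ^ a * pp d * px ^ c

theorem pflip_mul_pf (hn : 4 ≤ n) {d a c j : ℕ} (h : FlipParams n d a c) (h1 : j ≠ c)
    (h2 : j ≠ c + (n - d)) : (pflip d a c * pf j : Pres n) = pflip d a c := by
  obtain hj | hj := le_or_gt n j
  · rw [pf_eq_one hn hj, mul_one]
  rw [pflip, mul_assoc]
  obtain h3 | h3 := lt_or_ge j c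
  · rw [px_pow_mul_pf_of_lt hn hj h3]
  · rw [px_pow_mul_pf_of_le hn hj h3, mul_assoc, ← mul_assoc (pp d),
      pp_mul_pf hn h.pos h.lt h.ne (by omega) (by omega), mul_assoc]

theorem pflip_mul_pf_mem (hn : 4 ≤ n) {d a c j : ℕ} (h : FlipParams n d a c)
    (hj : j = c ∨ j = c + (n - d)) : (pflip d a c * pf j : Pres n) ∈ transl n := by
  have := h.im
  have := h.lt
  rw [pflip, mul_assoc, px_pow_mul_pf_of_le hn (by omega) (by omega), mul_assoc,
    ← mul_assoc (pp d)]
  exact mul_mem (pow_mem py_mem _)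
    (mul_mem (pp_mul_pf_mem hn h.pos h.lt h.ne (by omega)) (pow_mem px_mem _))

theorem pf_mul_pflip (hn : 4 ≤ n) {d a c : ℕ} (h : FlipParams n d a c) (j : ℕ) :
    pf j * pflip d a c ∈ transl n ∨ (pf j * pflip d a c : Pres n) = pflip d a c := by
  obtain h1 | h1 := lt_or_ge j a
  · right
    rw [pflip, ← mul_assoc, ← mul_assoc, pf_mul_py_pow_of_lt hn h1]
  obtain hj | hj := le_or_gt n j
  · right
    rw [pf_eq_one hn hj, one_mul]
  obtain ⟨j, rfl⟩ := Nat.exists_eq_add_of_le' h1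
  rw [pflip, ← mul_assoc, ← mul_assoc, ← py_pow_mul_pf_of_lt hn hj, mul_assoc (py ^ a)]
  by_cases h2 : j = 0 ∨ j = d
  · left
    exact mul_mem (mul_mem (pow_mem py_mem _) (pf_mul_pp_mem hn h.pos h.lt h.ne h2))
      (pow_mem px_mem _)
  · right
    rw [pf_mul_pp hn h.pos h.lt h.ne (by omega) (by omega)]

/-- The elements of the presented monoid which are restrictions of translations or of the form
`pflip d a c`. Every element turns out to be of this kind. -/
def IsNormal (m : Pres n) : Prop :=
  m ∈ transl n ∨ ∃ d a c, FlipParams n d a c ∧ m = pflip d a c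

theorem pfs_mul_pflip (hn : 4 ≤ n) {d a c : ℕ} (h : FlipParams n d a c) (l : List ℕ) :
    pfs l * pflip d a c ∈ transl n ∨ (pfs l * pflip d a c : Pres n) = pflip d a c := by
  induction l with
  | nil => simp
  | cons j l ih =>
    rw [pfs_cons, mul_assoc]
    rcases ih with ih | ih
    · exact .inl (mul_mem (pf_mem j) ih)
    · rw [ih]
      exact pf_mul_pflip hn h j

theorem isNormal_transl_mul_pp (hn : 4 ≤ n) {d : ℕ} (h0 : 0 < d) (h1 : d < n) (h2 : 2 * d ≠ n)
    {m : Pres n} (hm : m ∈ transl n) : IsNormal (m * pp d) := by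
  -- a translation whose image misses a point of the domain `{0, d}` of `pp d` absorbs an idempotent
  have habs {g : Pres n} (hg : g ∈ transl n) {j : ℕ} (hj : j = 0 ∨ j = d) (hgj : g * pf j = g) :
      g * pp d ∈ transl n := by
    rw [← hgj, mul_assoc]
    exact mul_mem hg (pf_mul_pp_mem hn h0 h1 h2 hj)
  obtain ⟨l, k, rfl⟩ := exists_eq_pfs_mul_pshift hn hm
  rw [mul_assoc]
  obtain ⟨a, rfl | rfl⟩ : ∃ a : ℕ, k = (a + 1 : ℕ) ∨ k = -a := by
    obtain ⟨k, rfl | rfl⟩ := k.eq_nat_or_neg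
    · cases k with
      | zero => exact ⟨0, by simp⟩
      | succ k => exact ⟨k, .inl rfl⟩
    · exact ⟨k, .inr rfl⟩
  · rw [pshift_natCast]
    exact .inl (mul_mem (pfs_mem l) (habs (pow_mem px_mem _) (.inl rfl)
      (px_pow_mul_pf_of_lt hn (by omega) (by omega))))
  · rw [pshift_neg_natCast]
    obtain h3 | h3 := lt_or_ge (a + d) n
    · have h : FlipParams n d a 0 := ⟨h0, h1, h2, h3, h0⟩
      have heq : (py ^ a * pp d : Pres n) = pflip d a 0 := by rw [pflip, pow_zero, mul_one]
      rw [heq]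
      exact (pfs_mul_pflip hn h l).imp id fun h' => ⟨d, a, 0, h, h'⟩
    · exact .inl (mul_mem (pfs_mem l) (habs (pow_mem py_mem _) (.inr rfl)
        (py_pow_mul_pf_of_le hn (by omega))))

theorem isNormal_pflip_mul_pf (hn : 4 ≤ n) {d a c : ℕ} (h : FlipParams n d a c) (j : ℕ) :
    IsNormal (pflip d a c * pf j : Pres n) := by
  by_cases hj : j = c ∨ j = c + (n - d)
  · exact .inl (pflip_mul_pf_mem hn h hj)
  · rw [pflip_mul_pf hn h (by omega) (by omega)]
    exact .inr ⟨d, a, c, h, rfl⟩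

theorem isNormal_pflip_mul_px (hn : 4 ≤ n) {d a c : ℕ} (h : FlipParams n d a c) :
    IsNormal (pflip d a c * px : Pres n) := by
  have := h.im
  have := h.lt
  obtain hc | hc := eq_or_ne (c + 1) d
  · -- the larger point of the image is the last one
    left
    rw [← pf_last_mul_px hn, ← mul_assoc]
    exact mul_mem (pflip_mul_pf_mem hn h (by omega)) px_mem
  · refine .inr ⟨d, a, c + 1, ⟨h.pos, h.lt, h.ne, h.dom, by omega⟩, ?_⟩
    rw [pflip, pflip, pow_succ]
    simp only [mul_assoc]

theorem isNormal_pflip_mul_py (hn : 4 ≤ n) {d a c : ℕ} (h : FlipParams n d a c) :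
    IsNormal (pflip d a c * py : Pres n) := by
  have := h.im
  have := h.lt
  cases c with
  | zero =>
    left
    rw [← pf_zero_mul_py, ← mul_assoc]
    exact mul_mem (pflip_mul_pf_mem hn h (.inl rfl)) py_mem
  | succ c =>
    have h' : FlipParams n d a c := ⟨h.pos, h.lt, h.ne, h.dom, by omega⟩
    refine .inr ⟨d, a, c, h', ?_⟩
    calc (pflip d a (c + 1) * py : Pres n) = pflip d a c * pf (n - 1) := by
          rw [pflip, pflip, pow_succ, pf_last hn]
          simp only [mul_assoc]
      _ = pflip d a c := pflip_mul_pf hn h' (by omega) (by omega)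

theorem isNormal_pflip_mul_pp (hn : 4 ≤ n) {d a c d' : ℕ} (h : FlipParams n d a c) (h0 : 0 < d')
    (h1 : d' < n) (h2 : 2 * d' ≠ n) : IsNormal (pflip d a c * pp d' : Pres n) := by
  have := h.im
  have := h.lt
  -- a point of the image of the first factor outside the domain of the second one can be removed
  have habs {j : ℕ} (hj : j = c ∨ j = c + (n - d)) (hj0 : j ≠ 0) (hjd : j ≠ d') :
      IsNormal (pflip d a c * pp d' : Pres n) := by
    rw [← pf_mul_pp hn h0 h1 h2 hj0 hjd, ← mul_assoc]
    exact isNormal_transl_mul_pp hn h0 h1 h2 (pflip_mul_pf_mem hn h hj)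
  by_cases h3 : c ≠ 0 ∧ c ≠ d'
  · exact habs (.inl rfl) h3.1 h3.2
  by_cases h4 : c + (n - d) ≠ d'
  · exact habs (.inr rfl) (by omega) h4
  obtain rfl : c = 0 := by omega
  obtain rfl : d' = n - d := by omega
  left
  rw [pflip, pow_zero, mul_one, mul_assoc]
  exact mul_mem (pow_mem py_mem _) (pp_mul_pp_mem h.pos h.lt h.ne)

theorem isNormal_mul_letter (hn : 4 ≤ n) {m : Pres n} (hm : IsNormal m) (b : Letter n) :
    IsNormal (m * cls (FreeMonoid.of b)) := by
  have hpp {d : ℕ} (h0 : 0 < d) (h1 : d < n) (h2 : 2 * d ≠ n) : IsNormal (m * pp d) := by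
    rcases hm with hm | ⟨d', a, c, h, rfl⟩
    · exact isNormal_transl_mul_pp hn h0 h1 h2 hm
    · exact isNormal_pflip_mul_pp hn h h0 h1 h2
  cases b with
  | x =>
    rcases hm with hm | ⟨d, a, c, h, rfl⟩
    · exact .inl (mul_mem hm px_mem)
    · exact isNormal_pflip_mul_px hn h
  | y =>
    rcases hm with hm | ⟨d, a, c, h, rfl⟩
    · exact .inl (mul_mem hm py_mem)
    · exact isNormal_pflip_mul_py hn h
  | e i hi =>
    have heq : cls (FreeMonoid.of (.e i hi)) = (pf (i - 1) : Pres n) := by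
      rw [← cls_e hi, Word.e, dif_pos hi]
    rw [heq]
    rcases hm with hm | ⟨d, a, c, h, rfl⟩
    · exact .inl (mul_mem hm (pf_mem _))
    · exact isNormal_pflip_mul_pf hn h _
  | xs i hi =>
    have heq : cls (FreeMonoid.of (.xs i hi)) = (pp i : Pres n) := by
      rw [pp_of_lt (by omega), Word.xs, dif_pos hi]
    rw [heq]
    exact hpp (by omega) (by omega) (by omega)
  | ys i hi =>
    have heq : cls (FreeMonoid.of (.ys i hi)) = (pp (n - i) : Pres n) := by
      rw [pp_sub (by omega) (by omega), Word.ys, dif_pos hi]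
    rw [heq]
    exact hpp (by omega) (by omega) (by omega)

theorem isNormal (hn : 4 ≤ n) (m : Pres n) : IsNormal m := by
  have hm : m ∈ Submonoid.closure (Set.range (PresentedMonoid.of _)) :=
    PresentedMonoid.closure_range_of (fun u v : Word n => (u, v) ∈ V n) ▸ Submonoid.mem_top m
  induction hm using Submonoid.closure_induction_right with
  | one => exact .inl (one_mem _)
  | mul_right m _ g hg ih =>
    obtain ⟨b, rfl⟩ := hg
    exact isNormal_mul_letter hn ih b

theorem maps_sem_pflip (hn : 4 ≤ n) {d a c : ℕ} (h : FlipParams n d a c) {s t : ℤ} :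
    Maps (sem hn (pflip d a c)) s t ↔ s = a ∧ t = c ∨ s = a + d ∧ t = c + (n - d) := by
  have := h.im
  have := h.dom
  rw [← one_mul (sem hn _), pflip, map_mul, map_mul, ← mul_assoc, ← mul_assoc, map_pow, map_pow,
    sem_px, sem_py, maps_mul_shift_pow, maps_mul_sem_pp hn h.pos h.lt h.ne,
    maps_mul_shift_symm_pow, maps_mul_shift_symm_pow, maps_one, maps_one]
  omega

theorem sem_injective (hn : 4 ≤ n) : Function.Injective (sem (n := n) hn) := by
  -- a map `a ↦ c`, `a + d ↦ c + (n - d)` with `2 d ≠ n` is not a translation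
  have hne {m : Pres n} (hm : m ∈ transl n) {d a c : ℕ} (h : FlipParams n d a c) :
      sem hn m ≠ sem hn (pflip d a c) := by
    intro heq
    obtain ⟨l, k, rfl⟩ := exists_eq_pfs_mul_pshift hn hm
    have h1 := (maps_sem_pflip hn h (s := a) (t := c)).2 (by simp)
    have h2 := (maps_sem_pflip hn h (s := a + d) (t := c + (n - d))).2 (by simp)
    rw [← heq, maps_sem_transl] at h1 h2
    have := h.ne
    omega
  intro m m' heq
  rcases isNormal hn m with hm | ⟨d, a, c, h, rfl⟩ <;>
    rcases isNormal hn m' with hm' | ⟨d', a', c', h', rfl⟩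
  · exact transl_injOn hn hm hm' heq
  · exact (hne hm h' heq).elim
  · exact (hne hm' h heq.symm).elim
  · have h1 := (maps_sem_pflip hn h (s := a) (t := c)).2 (by simp)
    have h2 := (maps_sem_pflip hn h (s := a + d) (t := c + (n - d))).2 (by simp)
    rw [heq, maps_sem_pflip hn h'] at h1 h2
    have := h.pos
    obtain rfl : a = a' := by omega
    obtain rfl : d = d' := by omega
    obtain rfl : c = c' := by omega
    rfl

theorem sem_mem_ODI (hn : 4 ≤ n) (m : Pres n) : sem hn m ∈ ODI n := by
  obtain ⟨w, rfl⟩ := PresentedMonoid.surjective_mk m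
  induction w using FreeMonoid.recOn with
  | one => exact one_mem _
  | of_mul b w hw =>
    rw [map_mul, map_mul]
    exact mul_mem (gen_mem_ODI b) hw

theorem exists_sem_eq (hn : 4 ≤ n) {α : SymInv n} (h : α ∈ ODI n) : ∃ m, sem hn m = α := by
  classical
  by_cases htr : ∃ k : ℤ, ∀ a b, Maps α a b → b = a + k
  · obtain ⟨k, hk⟩ := htr
    refine ⟨pfs ((List.range n).filter fun j => ¬∃ b, Maps α j b) * pshift k, ?_⟩
    refine ext_maps fun a b => ?_
    rw [maps_sem_transl]
    constructor
    · rintro ⟨rfl, h0, h1, h2, h3, h4⟩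
      lift a to ℕ using h0
      by_contra hα
      refine h4 a ?_ rfl
      rw [List.mem_filter, decide_eq_true_iff, List.mem_range]
      refine ⟨by omega, ?_⟩
      rintro ⟨b, hb⟩
      rw [hk _ _ hb] at hb
      exact hα hb
    · intro hα
      have hb := hα.bounds
      refine ⟨hk _ _ hα, hb.1, hb.2.1, hb.2.2.1, hb.2.2.2, fun j hj haj => ?_⟩
      rw [List.mem_filter, decide_eq_true_iff] at hj
      exact hj.2 ⟨b, haj ▸ hα⟩
  · obtain ⟨a, b, a', b', hab, hab', hd, ha, hb, hall⟩ := (ODI_cases h).resolve_left htr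
    have hα {s t : ℤ} (hst : Maps α s t) : s = a ∧ t = a' ∨ s = b ∧ t = b' := by
      rcases hall _ _ hst with rfl | rfl
      · exact .inl ⟨rfl, hst.right_unique ha⟩
      · exact .inr ⟨rfl, hst.right_unique hb⟩
    have h2 : 2 * (b - a) ≠ n := fun h2 => htr ⟨a' - a, fun s t hst => by
      have := hα hst
      omega⟩
    have h3 := ha.bounds
    have h4 := hb.bounds
    have hp : FlipParams n (b - a).toNat a.toNat a'.toNat :=
      ⟨by omega, by omega, by omega, by omega, by omega⟩
    refine ⟨_, ext_maps fun s t => (maps_sem_pflip hn hp).trans ⟨?_, fun hst => ?_⟩⟩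
    · rintro (⟨rfl, rfl⟩ | ⟨rfl, rfl⟩)
      · rwa [Int.toNat_of_nonneg (by omega), Int.toNat_of_nonneg (by omega)]
      · convert hb using 1 <;> omega
    · have := hα hst
      omega

/-- The presented monoid is `ODI n`. -/
noncomputable def presEquiv (hn : 4 ≤ n) : Pres n ≃* ODI n :=
  MulEquiv.ofBijective ((sem hn).codRestrict (ODI n) (sem_mem_ODI hn))
    ⟨fun _ _ h => sem_injective hn (congrArg Subtype.val h), fun α =>
      (exists_sem_eq hn α.2).imp fun _ h => Subtype.ext h⟩

theorem closure_range_gen (hn : 4 ≤ n) : Submonoid.closure (Set.range (gen n)) = ODI n := by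
  refine le_antisymm (Submonoid.closure_le.2 ?_) fun α hα => ?_
  · rintro _ ⟨b, rfl⟩
    exact gen_mem_ODI b
  · obtain ⟨m, rfl⟩ := exists_sem_eq hn hα
    obtain ⟨w, rfl⟩ := PresentedMonoid.surjective_mk m
    rw [← FreeMonoid.mrange_lift]
    exact ⟨w, rfl⟩

/-! ### Counting letters and relations -/

/-- The indices `i` of the letters `e_i`. -/
abbrev EIdx (n : ℕ) : Type := Finset.Icc 2 (n - 1)

/-- The indices `i` of the letters `x_i` and `y_i`. -/
abbrev PIdx (n : ℕ) : Type := Finset.Icc 1 ((n - 1) / 2)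

/-- The letters, sorted by kind. -/
def letterEquiv (n : ℕ) : Letter n ≃ Fin 2 ⊕ EIdx n ⊕ Fin 2 × PIdx n where
  toFun
    | .x => .inl 0
    | .y => .inl 1
    | .e i h => .inr (.inl ⟨i, Finset.mem_Icc.2 h⟩)
    | .xs i h => .inr (.inr (0, ⟨i, Finset.mem_Icc.2 h⟩))
    | .ys i h => .inr (.inr (1, ⟨i, Finset.mem_Icc.2 h⟩))
  invFun
    | .inl 0 => .x
    | .inl 1 => .y
    | .inr (.inl i) => .e i (Finset.mem_Icc.1 i.2)
    | .inr (.inr (0, i)) => .xs i (Finset.mem_Icc.1 i.2)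
    | .inr (.inr (1, i)) => .ys i (Finset.mem_Icc.1 i.2)
  left_inv b := by cases b <;> rfl
  right_inv b := by
    rcases b with k | i | ⟨k, i⟩
    · fin_cases k <;> rfl
    · rfl
    · fin_cases k <;> rfl

theorem neg_one_pow_cases {R : Type*} [Ring R] (n : ℕ) :
    (n = 2 * ((n - 1) / 2) + 2 ∧ (-1 : R) ^ n = 1) ∨
      (n = 2 * ((n - 1) / 2) + 1 ∧ (-1 : R) ^ n = -1) ∨ n = 0 := by
  rcases Nat.even_or_odd n with h | h
  · rw [h.neg_one_pow]
    obtain ⟨k, rfl⟩ := h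
    simp
    omega
  · rw [h.neg_one_pow]
    obtain ⟨k, rfl⟩ := h
    simp

theorem card_letter (hn : 4 ≤ n) :
    (Nat.card (Letter n) : ℚ) = 2 * (n : ℚ) - (3 + (-1) ^ n) / 2 := by
  rw [Nat.card_congr (letterEquiv n)]
  simp only [Nat.card_eq_fintype_card, Fintype.card_sum, Fintype.card_prod, Fintype.card_fin,
    Fintype.card_coe, Nat.card_Icc]
  obtain ⟨m, hm⟩ : ∃ m, m = (n - 1) / 2 := ⟨_, rfl⟩
  rw [← hm, show n - 1 + 1 - 2 = n - 2 by omega]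
  push_cast [Nat.cast_sub (show 2 ≤ n by omega)]
  rcases neg_one_pow_cases (R := ℚ) n with ⟨h, h'⟩ | ⟨h, h'⟩ | h
  · rw [h', h, ← hm]
    push_cast
    ring
  · rw [h', h, ← hm]
    push_cast
    ring
  · omega

/-- The left-hand sides of the relations in `V`, named by their shape. Each of them occurs in
exactly one relation: where two families of relations have left-hand sides of the same
shape, such as `Rel.v11_x` and `Rel.v14'` for `e_j x_i`, the index sets are complementary. -/
inductive LhsIdx (n : ℕ) : Type
  | ee (i j : EIdx n) (h : i ≤ j)
  | xyx | yxy | yxxy | xxy | yxx | yxexy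
  | xye (i : EIdx n)
  | yxe (i : EIdx n)
  | xe (i : Finset.Icc 2 (n - 2))
  | xsys (i : PIdx n)
  | ysxs (i : PIdx n)
  | xse (i : PIdx n) (j : EIdx n)
  | eys (i : PIdx n) (j : EIdx n)
  | exs (i : PIdx n) (j : EIdx n)
  | yse (i : PIdx n) (j : EIdx n)
  | xsxy (i : PIdx n)
  | xyxs (i : PIdx n)
  | xyys (i : PIdx n)
  | ysxy (i : PIdx n)
  | yxxs (i : PIdx n)
  | xsyx (i : PIdx n)
  | yxys (i : PIdx n)
  | ysyx (i : PIdx n)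

namespace LhsIdx

open Word

/-- The left-hand side with a given name. -/
def lhs : LhsIdx n → Word n
  | ee i j _ => e i * e j
  | xyx => x * y * x
  | yxy => y * x * y
  | yxxy => y * x ^ 2 * y
  | xxy => x ^ 2 * y
  | yxx => y * x ^ 2
  | yxexy => y * x * es 2 (n - 1) * (x * y)
  | xye i => x * y * e i
  | yxe i => y * x * e i
  | xe i => x * e (i + 1)
  | xsys i => xs i * ys i
  | ysxs i => ys i * xs i
  | xse i j => xs i * e j
  | eys i j => e j * ys i
  | exs i j => e j * xs i
  | yse i j => ys i * e j
  | xsxy i => xs i * (x * y)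
  | xyxs i => x * y * xs i
  | xyys i => x * y * ys i
  | ysxy i => ys i * (x * y)
  | yxxs i => y * x * xs i
  | xsyx i => xs i * (y * x)
  | yxys i => y * x * ys i
  | ysyx i => ys i * (y * x)

/-- The right-hand side of the relation with a given left-hand side. -/
def rhs : LhsIdx n → Word n
  | ee i j _ => if i = j then e i else e j * e i
  | xyx => x
  | yxy => y
  | yxxy => x * y ^ 2 * x
  | xxy => e (n - 1) * x
  | yxx => x * e 2
  | yxexy => x * es 2 (n - 1) * (x * y)
  | xye i => e i * (x * y)
  | yxe i => e i * (y * x)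
  | xe i => e i * x
  | xsys i => es 2 i * es (i + 2) (n - 1) * (x * y)
  | ysxs i => if (i : ℕ) = 1 then es 2 (n - 1)
      else es 2 (n - i) * es (n - i + 2) (n - 1) * (x * y)
  | xse i j => if (j : ℕ) = n - i + 1 then e (i + 1) * xs i else xs i
  | eys i j => if (j : ℕ) = n - i + 1 then es 2 (n - 1) * (x * y) else ys i
  | exs i j => if (j : ℕ) = i + 1 then ys i * e (i + 1) else xs i
  | yse i j => if (j : ℕ) = i + 1 then
      if (i : ℕ) = 1 then x * y * ys 1 else e (n - i + 1) * ys i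
      else ys i
  | xsxy i => if (i : ℕ) = 1 then e 2 * xs 1 else x * y * xs i
  | xyxs i => xs i
  | xyys i => if (i : ℕ) = 1 then es 2 (n - 1) * (x * y) else ys i * (x * y)
  | ysxy i => ys i
  | yxxs i => xs i * (y * x)
  | xsyx i => if (i : ℕ) = 1 then x ^ (n - 2) * e (n - 1)
      else x ^ (n - 2 * i) * es (n - 2 * i + 1) (n - i) * es (n - i + 2) (n - 1) * (x * y)
  | yxys i => ys i * (y * x)
  | ysyx i => y ^ (n - 2 * i + 1) * x * es 2 i * es (i + 2) (2 * i)

/-- The names of left-hand sides, sorted by the letters they involve. -/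
def equivSum (n : ℕ) : LhsIdx n ≃ {p : EIdx n × EIdx n // p.1 ≤ p.2} ⊕ Fin 6 ⊕ Fin 2 × EIdx n ⊕
    Finset.Icc 2 (n - 2) ⊕ Fin 2 × PIdx n ⊕ Fin 4 × PIdx n × EIdx n ⊕ Fin 8 × PIdx n where
  toFun
    | ee i j h => .inl ⟨(i, j), h⟩
    | xyx => .inr (.inl 0)
    | yxy => .inr (.inl 1)
    | yxxy => .inr (.inl 2)
    | xxy => .inr (.inl 3)
    | yxx => .inr (.inl 4)
    | yxexy => .inr (.inl 5)
    | xye i => .inr (.inr (.inl (0, i)))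
    | yxe i => .inr (.inr (.inl (1, i)))
    | xe i => .inr (.inr (.inr (.inl i)))
    | xsys i => .inr (.inr (.inr (.inr (.inl (0, i)))))
    | ysxs i => .inr (.inr (.inr (.inr (.inl (1, i)))))
    | xse i j => .inr (.inr (.inr (.inr (.inr (.inl (0, i, j))))))
    | eys i j => .inr (.inr (.inr (.inr (.inr (.inl (1, i, j))))))
    | exs i j => .inr (.inr (.inr (.inr (.inr (.inl (2, i, j))))))
    | yse i j => .inr (.inr (.inr (.inr (.inr (.inl (3, i, j))))))
    | xsxy i => .inr (.inr (.inr (.inr (.inr (.inr (0, i))))))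
    | xyxs i => .inr (.inr (.inr (.inr (.inr (.inr (1, i))))))
    | xyys i => .inr (.inr (.inr (.inr (.inr (.inr (2, i))))))
    | ysxy i => .inr (.inr (.inr (.inr (.inr (.inr (3, i))))))
    | yxxs i => .inr (.inr (.inr (.inr (.inr (.inr (4, i))))))
    | xsyx i => .inr (.inr (.inr (.inr (.inr (.inr (5, i))))))
    | yxys i => .inr (.inr (.inr (.inr (.inr (.inr (6, i))))))
    | ysyx i => .inr (.inr (.inr (.inr (.inr (.inr (7, i))))))
  invFun
    | .inl p => ee p.1.1 p.1.2 p.2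
    | .inr (.inl k) => ![xyx, yxy, yxxy, xxy, yxx, yxexy] k
    | .inr (.inr (.inl (k, i))) => ![xye i, yxe i] k
    | .inr (.inr (.inr (.inl i))) => xe i
    | .inr (.inr (.inr (.inr (.inl (k, i))))) => ![xsys i, ysxs i] k
    | .inr (.inr (.inr (.inr (.inr (.inl (k, i, j)))))) => ![xse i j, eys i j, exs i j, yse i j] k
    | .inr (.inr (.inr (.inr (.inr (.inr (k, i)))))) =>
      ![xsxy i, xyxs i, xyys i, ysxy i, yxxs i, xsyx i, yxys i, ysyx i] k
  left_inv a := by cases a <;> rfl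
  right_inv a := by
    rcases a with p | k | ⟨k, i⟩ | i | ⟨k, i⟩ | ⟨k, i, j⟩ | ⟨k, i⟩
    · rfl
    · fin_cases k <;> rfl
    · fin_cases k <;> rfl
    · rfl
    · fin_cases k <;> rfl
    · fin_cases k <;> rfl
    · fin_cases k <;> rfl

theorem rel_lhs_rhs (a : LhsIdx n) : Rel n a.lhs a.rhs := by
  have hE (i : EIdx n) := Finset.mem_Icc.1 i.2
  have hP (i : PIdx n) := Finset.mem_Icc.1 i.2
  cases a <;> simp only [lhs, rhs]
  case ee i j hij =>
    have hi := hE i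
    have hj := hE j
    split_ifs with h
    · rw [h]
      exact .v1 j hj
    · have : (i : ℕ) < j := lt_of_le_of_ne hij fun h' => h (Subtype.ext h')
      exact .v4 i j (by omega)
  case xyx => exact .v2_x
  case yxy => exact .v2_y
  case yxxy => exact .v3
  case xxy => exact .v7_x
  case yxx => exact .v7_y
  case yxexy => exact .v8
  case xye i => exact .v5_xy i (hE i)
  case yxe i => exact .v5_yx i (hE i)
  case xe i => exact .v6 i (Finset.mem_Icc.1 i.2)
  case xsys i => exact .v9_xy i (hP i)
  case ysxs i =>
    have hi := hP i
    split_ifs with h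
    · rw [h]
      exact .v9_yx_one
    · exact .v9_yx i (by omega)
  case xse i j =>
    have hi := hP i
    have hj := hE j
    split_ifs with h
    · rw [h]
      exact .v14 i (by omega)
    · exact .v10_x i j hi (by omega)
  case eys i j =>
    have hi := hP i
    have hj := hE j
    split_ifs with h
    · rw [h]
      exact .v14''' i (by omega)
    · exact .v10_y i j hi (by omega)
  case exs i j =>
    have hi := hP i
    have hj := hE j
    split_ifs with h
    · rw [h]
      obtain h1 | h1 := eq_or_ne (i : ℕ) 1
      · rw [h1]
        exact .v14_one'
      · exact .v14' i (by omega)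
    · exact .v11_x i j hi (by omega)
  case yse i j =>
    have hi := hP i
    have hj := hE j
    split_ifs with h h1
    · rw [h, h1]
      exact .v14_one''
    · rw [h]
      exact .v14'' i (by omega)
    · exact .v11_y i j hi (by omega)
  case xsxy i =>
    have hi := hP i
    split_ifs with h
    · rw [h]
      exact .v14_one
    · exact .v12_x i (by omega)
  case xyxs i =>
    have hi := hP i
    obtain h | h := eq_or_ne (i : ℕ) 1
    · rw [h]
      exact .v12_x_one
    · exact .v12_x' i (by omega)
  case xyys i =>
    have hi := hP i
    split_ifs with h
    · rw [h]
      exact .v14_one'''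
    · exact .v12_y i (by omega)
  case ysxy i =>
    have hi := hP i
    obtain h | h := eq_or_ne (i : ℕ) 1
    · rw [h]
      exact .v12_y_one
    · exact .v12_y' i (by omega)
  case yxxs i =>
    have hi := hP i
    obtain h | h := eq_or_ne (i : ℕ) 1
    · rw [h]
      exact .v13_x_one
    · exact .v13_x i (by omega)
  case xsyx i =>
    have hi := hP i
    split_ifs with h
    · rw [h]
      exact .v13_x_one'
    · exact .v13_x' i (by omega)
  case yxys i => exact .v13_y i (hP i)
  case ysyx i => exact .v13_y' i (hP i)

theorem exists_of_rel (hn : 4 ≤ n) {u v : Word n} (h : Rel n u v) :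
    ∃ a : LhsIdx n, a.lhs = u ∧ a.rhs = v := by
  have E {i : ℕ} (h : 2 ≤ i ∧ i ≤ n - 1) : i ∈ Finset.Icc 2 (n - 1) := Finset.mem_Icc.2 h
  have P {i : ℕ} (h : 1 ≤ i ∧ i ≤ (n - 1) / 2) : i ∈ Finset.Icc 1 ((n - 1) / 2) :=
    Finset.mem_Icc.2 h
  cases h with
  | v1 i h => exact ⟨.ee ⟨i, E h⟩ ⟨i, E h⟩ le_rfl, rfl, if_pos rfl⟩
  | v2_x => exact ⟨.xyx, rfl, rfl⟩
  | v2_y => exact ⟨.yxy, rfl, rfl⟩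
  | v3 => exact ⟨.yxxy, rfl, rfl⟩
  | v4 i j h =>
    exact ⟨.ee ⟨i, E (by omega)⟩ ⟨j, E (by omega)⟩ h.2.1.le, rfl,
      if_neg fun h' => h.2.1.ne (congrArg Subtype.val h')⟩
  | v5_xy i h => exact ⟨.xye ⟨i, E h⟩, rfl, rfl⟩
  | v5_yx i h => exact ⟨.yxe ⟨i, E h⟩, rfl, rfl⟩
  | v6 i h => exact ⟨.xe ⟨i, Finset.mem_Icc.2 h⟩, rfl, rfl⟩
  | v7_x => exact ⟨.xxy, rfl, rfl⟩
  | v7_y => exact ⟨.yxx, rfl, rfl⟩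
  | v8 => exact ⟨.yxexy, rfl, rfl⟩
  | v9_xy i h => exact ⟨.xsys ⟨i, P h⟩, rfl, rfl⟩
  | v9_yx_one => exact ⟨.ysxs ⟨1, P (by omega)⟩, rfl, rfl⟩
  | v9_yx i h => exact ⟨.ysxs ⟨i, P (by omega)⟩, rfl, if_neg (show i ≠ 1 by omega)⟩
  | v10_x i j h hj => exact ⟨.xse ⟨i, P h⟩ ⟨j, E (by omega)⟩, rfl, if_neg hj.2.2⟩
  | v10_y i j h hj => exact ⟨.eys ⟨i, P h⟩ ⟨j, E (by omega)⟩, rfl, if_neg hj.2.2⟩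
  | v11_x i j h hj => exact ⟨.exs ⟨i, P h⟩ ⟨j, E (by omega)⟩, rfl, if_neg hj.2.2⟩
  | v11_y i j h hj => exact ⟨.yse ⟨i, P h⟩ ⟨j, E (by omega)⟩, rfl, if_neg hj.2.2⟩
  | v12_x i h => exact ⟨.xsxy ⟨i, P (by omega)⟩, rfl, if_neg (show i ≠ 1 by omega)⟩
  | v12_x' i h => exact ⟨.xyxs ⟨i, P (by omega)⟩, rfl, rfl⟩
  | v12_y i h => exact ⟨.xyys ⟨i, P (by omega)⟩, rfl, if_neg (show i ≠ 1 by omega)⟩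
  | v12_y' i h => exact ⟨.ysxy ⟨i, P (by omega)⟩, rfl, rfl⟩
  | v12_x_one => exact ⟨.xyxs ⟨1, P (by omega)⟩, rfl, rfl⟩
  | v12_y_one => exact ⟨.ysxy ⟨1, P (by omega)⟩, rfl, rfl⟩
  | v13_x_one => exact ⟨.yxxs ⟨1, P (by omega)⟩, rfl, rfl⟩
  | v13_x_one' => exact ⟨.xsyx ⟨1, P (by omega)⟩, rfl, rfl⟩
  | v13_x i h => exact ⟨.yxxs ⟨i, P (by omega)⟩, rfl, rfl⟩
  | v13_x' i h => exact ⟨.xsyx ⟨i, P (by omega)⟩, rfl, if_neg (show i ≠ 1 by omega)⟩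
  | v13_y i h => exact ⟨.yxys ⟨i, P h⟩, rfl, rfl⟩
  | v13_y' i h => exact ⟨.ysyx ⟨i, P h⟩, rfl, rfl⟩
  | v14_one => exact ⟨.xsxy ⟨1, P (by omega)⟩, rfl, rfl⟩
  | v14_one' => exact ⟨.exs ⟨1, P (by omega)⟩ ⟨2, E (by omega)⟩, rfl, rfl⟩
  | v14_one'' =>
    exact ⟨.yse ⟨1, P (by omega)⟩ ⟨2, E (by omega)⟩, rfl, rfl⟩
  | v14_one''' => exact ⟨.xyys ⟨1, P (by omega)⟩, rfl, rfl⟩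
  | v14 i h => exact ⟨.xse ⟨i, P (by omega)⟩ ⟨n - i + 1, E (by omega)⟩, rfl, if_pos rfl⟩
  | v14' i h => exact ⟨.exs ⟨i, P (by omega)⟩ ⟨i + 1, E (by omega)⟩, rfl, if_pos rfl⟩
  | v14'' i h =>
    exact ⟨.yse ⟨i, P (by omega)⟩ ⟨i + 1, E (by omega)⟩, rfl,
      (if_pos rfl).trans (if_neg (show i ≠ 1 by omega))⟩
  | v14''' i h => exact ⟨.eys ⟨i, P (by omega)⟩ ⟨n - i + 1, E (by omega)⟩, rfl, if_pos rfl⟩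

theorem toList_e {i : ℕ} (h : 2 ≤ i ∧ i ≤ n - 1) : (e i : Word n).toList = [.e i h] := by
  rw [e, dif_pos h, FreeMonoid.toList_of]

theorem toList_xs {i : ℕ} (h : 1 ≤ i ∧ i ≤ (n - 1) / 2) : (xs i : Word n).toList = [.xs i h] := by
  rw [xs, dif_pos h, FreeMonoid.toList_of]

theorem toList_ys {i : ℕ} (h : 1 ≤ i ∧ i ≤ (n - 1) / 2) : (ys i : Word n).toList = [.ys i h] := by
  rw [ys, dif_pos h, FreeMonoid.toList_of]

/-- The long left-hand side has at least two letters `e_i`. -/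
theorem toList_es (hn : 4 ≤ n) : (es 2 (n - 1) : Word n).toList =
    .e 2 (by omega) :: .e 3 (by omega) :: (es 4 (n - 1) : Word n).toList := by
  rw [es, show n - 1 + 1 - 2 = n - 1 + 1 - 4 + 1 + 1 by omega, List.range'_succ,
    List.range'_succ, List.map_cons, List.map_cons, List.prod_cons, List.prod_cons,
    FreeMonoid.toList_mul, FreeMonoid.toList_mul, toList_e (by omega), toList_e (by omega)]
  rfl

set_option maxHeartbeats 2000000 in
theorem lhs_injective (hn : 4 ≤ n) : Function.Injective (lhs (n := n)) := by
  have hx : (x : Word n).toList = [.x] := rfl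
  have hy : (y : Word n).toList = [.y] := rfl
  have he (i : EIdx n) := toList_e (Finset.mem_Icc.1 i.2)
  have he' (i : Finset.Icc 2 (n - 2)) := toList_e (n := n) (i := i + 1)
    (by have := Finset.mem_Icc.1 i.2; omega)
  have hxs (i : PIdx n) := toList_xs (Finset.mem_Icc.1 i.2)
  have hys (i : PIdx n) := toList_ys (Finset.mem_Icc.1 i.2)
  have hes := toList_es hn
  intro a b h
  replace h := congrArg FreeMonoid.toList h
  cases a <;>
    simp only [lhs, pow_two, FreeMonoid.toList_mul, hx, hy, he, he', hxs, hys, hes,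
      List.cons_append, List.nil_append] at h <;>
    cases b <;>
    simp only [FreeMonoid.toList_mul, hx, hy, he, he', hxs, hys, hes,
      List.cons_append, List.nil_append, List.cons.injEq, List.cons_ne_nil, List.nil_eq,
      Letter.e.injEq, Letter.xs.injEq, Letter.ys.injEq, reduceCtorEq, and_true, and_false,
      false_and, true_and, Nat.add_right_cancel_iff, ← Subtype.ext_iff] at h <;>
    simp [h]

end LhsIdx

theorem V_eq_range (hn : 4 ≤ n) : V n = Set.range fun a : LhsIdx n => (a.lhs, a.rhs) := by
  ext ⟨u, v⟩
  constructor
  · intro h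
    obtain ⟨a, rfl, rfl⟩ := LhsIdx.exists_of_rel hn h
    exact ⟨a, rfl⟩
  · rintro ⟨a, h⟩
    obtain ⟨rfl, rfl⟩ := Prod.mk.inj h
    exact a.rel_lhs_rhs

instance (n : ℕ) : Finite (LhsIdx n) := Finite.of_equiv _ (LhsIdx.equivSum n).symm

theorem V_finite (hn : 4 ≤ n) : (V n).Finite := by
  rw [V_eq_range hn]
  exact Set.finite_range _

theorem card_V (hn : 4 ≤ n) : ((V n).ncard : ℚ) =
    (5 * (n : ℚ) ^ 2 - (1 + 2 * (-1) ^ n) * (n : ℚ) + (-1) ^ (n + 1) - 3) / 2 := by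
  have hinj : Function.Injective fun a : LhsIdx n => (a.lhs, a.rhs) := fun a b h =>
    LhsIdx.lhs_injective hn (congrArg Prod.fst h)
  rw [V_eq_range hn, ← Set.image_univ, Set.ncard_image_of_injective _ hinj, Set.ncard_univ,
    Nat.card_congr (LhsIdx.equivSum n), Nat.card_sum, ← Nat.card_congr Sym2.sortEquiv]
  simp only [Nat.card_eq_fintype_card, Sym2.card, Fintype.card_sum, Fintype.card_prod,
    Fintype.card_fin, Fintype.card_coe, Nat.card_Icc]
  obtain ⟨m, hm⟩ : ∃ m, m = (n - 1) / 2 := ⟨_, rfl⟩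
  rw [← hm, show n - 1 + 1 - 2 = n - 2 by omega, show n - 2 + 1 - 2 = n - 3 by omega]
  push_cast [Nat.cast_choose_two, Nat.cast_sub (show 2 ≤ n by omega),
    Nat.cast_sub (show 3 ≤ n by omega)]
  rw [pow_succ (-1 : ℚ)]
  rcases neg_one_pow_cases (R := ℚ) n with ⟨h, h'⟩ | ⟨h, h'⟩ | h
  · rw [h', h, ← hm]
    push_cast
    ring
  · rw [h', h, ← hm]
    push_cast
    ring
  · omega

end DihedralInverse

open DihedralInverse in
theorem theorem3p7 (n : ℕ) (hn : 4 ≤ n) :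
    -- the letters of the alphabet denote distinct elements, which form a generating set
    -- of minimum size
    (Function.Injective (gen n) ∧
      Submonoid.closure (Set.range (gen n)) = ODI n ∧
      ∀ S : Set (SymInv n), Submonoid.closure S = ODI n →
        (Set.range (gen n)).encard ≤ S.encard) ∧
    -- the monoid is defined by the presentation, each letter standing for its generator
    (∃ f : PresentedMonoid (fun u v : Word n => (u, v) ∈ V n) ≃* ODI n,
      ∀ b : Letter n, (f (PresentedMonoid.of _ b) : SymInv n) = gen n b) ∧
    -- the number of generators and the number of relations
    ((Nat.card (Letter n) : ℚ) = 2 * (n : ℚ) - (3 + (-1) ^ n) / 2 ∧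
      (V n).Finite ∧
      ((V n).ncard : ℚ) =
        (5 * (n : ℚ) ^ 2 - (1 + 2 * (-1) ^ n) * (n : ℚ) + (-1) ^ (n + 1) - 3) / 2) := by
  exact ⟨⟨gen_injective hn, closure_range_gen hn, fun _ hS => encard_range_gen_le hn hS⟩,
    ⟨presEquiv hn, fun _ => rfl⟩, card_letter hn, V_finite hn, card_V hn⟩
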